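/- All graphs are finite, simple and undirected. A graph is outerplanar if it can be drawn in the plane without crossings so that every vertex lies on the boundary of the unbounded face. A bipartite outerplanar graph is maximal if no edge can be added to it (on the same vertex set) so that the graph stays simple, bipartite and outerplanar. A graph is 2-connected if it has at least 3 vertices and is connected and remains connected after the deletion of any one vertex. A 1-sum of two disjoint graphs is a graph obtained from them by identifying one vertex of the first with one vertex of the second. Theorem. Let $G$ be a bipartite outerplanar graph with $n$ vertices and $m$ edges. (a) If $n\ge 4$ is even, then $m\le \frac32 n-2$, with equality if and only if $G$ is 2-connected and is a maximal bipartite outerplanar graph. (b) If $n\ge 3$ is odd, then $m\le \frac32 n-\frac52$, with equality if and only if $G$ is a 1-sum of two graphs of even order, each of which is either $K_2$ or a 2-connected maximal bipartite outerplanar graph. (c) If $n=2$, then $m\le \frac32 n-2=1$, with equality if and only if $G\cong K_2$. If $n=1$, then $m=0$ and $G\cong K_1$. -/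

import Mathlib

universe u v w

namespace SimpleGraph

/-- A drawing of the graph `G` in the plane (identified with `ℂ`) in which edges meet only at their
common ends: distinct vertices are distinct points, each edge is a simple arc (an injective
continuous path) joining its two ends, an arc contains no vertices other than its ends, and
two distinct arcs share no point other than a common end. -/
structure PlaneEmbedding {V : Type u} (G : SimpleGraph V) where
  /-- the point representing a vertex -/
  pos : V → ℂ
  /-- the point set of the arc representing an edge -/
  arc : G.edgeSet → Set ℂ
  pos_injective : Function.Injective pos
  arc_spec : ∀ (x y : V) (h : G.Adj x y), ∃ γ : _root_.Path (pos x) (pos y),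
    Function.Injective γ ∧ Set.range γ = arc ⟨s(x, y), h⟩
  mem_of_pos_mem_arc : ∀ (e : G.edgeSet) (x : V), pos x ∈ arc e → x ∈ (e : Sym2 V)
  arc_inter_arc : ∀ e f : G.edgeSet, e ≠ f →
    arc e ∩ arc f ⊆ pos '' {x | x ∈ (e : Sym2 V) ∧ x ∈ (f : Sym2 V)}

/-- All points of the plane covered by the drawing. -/
def PlaneEmbedding.support {V : Type u} {G : SimpleGraph V} (E : G.PlaneEmbedding) : Set ℂ :=
  Set.range E.pos ∪ ⋃ e, E.arc e

/-- The outer face: the points of the complement of the drawing whose connected component in that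
complement is unbounded. (The faces are these components; for a finite graph the drawing is
compact, so that exactly one of them is unbounded.) -/
def PlaneEmbedding.outerFace {V : Type u} {G : SimpleGraph V} (E : G.PlaneEmbedding) : Set ℂ :=
  {z | z ∈ E.supportᶜ ∧ ¬ Bornology.IsBounded (connectedComponentIn E.supportᶜ z)}

/-- `G` has a plane embedding with every vertex on the boundary of the outer face. -/
def IsOuterplanar {V : Type u} (G : SimpleGraph V) : Prop :=
  ∃ E : G.PlaneEmbedding, ∀ x : V, E.pos x ∈ frontier E.outerFace

/-- `G` is bipartite outerplanar, and adding any single missing edge destroys bipartiteness or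
outerplanarity. -/
def IsMaximalBipartiteOuterplanar {V : Type u} (G : SimpleGraph V) : Prop :=
  G.IsBipartite ∧ G.IsOuterplanar ∧
    ∀ x y : V, x ≠ y → ¬ G.Adj x y →
      ¬ ((G ⊔ SimpleGraph.edge x y).IsBipartite ∧ (G ⊔ SimpleGraph.edge x y).IsOuterplanar)

/-- `G` is `k`-connected: it has at least `k + 1` vertices, and deleting fewer than `k` vertices
never disconnects it. -/
def IsKVertexConnected {V : Type u} (G : SimpleGraph V) (k : ℕ) : Prop :=
  k + 1 ≤ Nat.card V ∧ ∀ S : Finset V, S.card < k → (G.induce ((S : Set V)ᶜ)).Connected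

/-- `J` is (up to isomorphism) a 1-sum of `G` and `H`: it is obtained from disjoint copies of `G`
and `H` by identifying a vertex `a` of `G` with a vertex `b` of `H`, and nothing else. -/
def IsOneSum {V : Type u} {W : Type v} {X : Type w}
    (G : SimpleGraph V) (H : SimpleGraph W) (J : SimpleGraph X) : Prop :=
  ∃ (f : V ↪ X) (g : W ↪ X) (a : V) (b : W),
    (∀ (x : V) (y : W), f x = g y ↔ x = a ∧ y = b) ∧
    Set.range f ∪ Set.range g = Set.univ ∧
    J = G.map f ⊔ H.map g

end SimpleGraph

/-! Topology enters through one forbidden configuration. In an outerplanar graph no two vertices are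
joined through three disjoint connected sets of further vertices (`ThetaFree`): three such paths
would form a theta curve, and the outer face, a connected set, would have a vertex from the interior
of each of its three arcs on its boundary. This contradicts `theta_curve`, which rests on a
criterion of Eilenberg: points p, q off a compact set K lie in one component of the complement
exactly when (z - p) / (z - q) has a continuous logarithm on K. Conversely, a graph whose vertices
can be ordered without crossing edges is outerplanar: draw its edges as chords of a parabola
(`isOuterplanar_of_not_cross`).

A 2-connected theta-free graph has a Hamiltonian cycle, because a longest cycle that misses a vertex
either can be lengthened or yields a theta. If the graph is bipartite, then n is even and the other
edges are pairwise noncrossing chords between positions of different parity. Cutting the polygon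
into pieces gives 2m + 4 ≤ 3n, with equality once no chord can be added (`IsDissection.card`).

A graph on at least three vertices that is not 2-connected splits into two smaller graphs with at
most one common vertex. By induction m ≤ (3n - 4)/2 for n ≥ 2. A split into orders a and b at a
common vertex has a + b = n + 1, so it allows only (3a - 4)/2 + (3b - 4)/2 = (3n - 5)/2 edges. For
even n, equality therefore forces 2-connectedness; it also forces maximality, since the bound holds
for every enlarged graph as well. For odd n, equality forces a 1-sum of two graphs of even order
that attain their own bounds. -/

section PlaneTopology

open Set Topology Metric Bornology

/-! ### Continuous logarithms of plane functions -/

section ContinuousLog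

/-- A continuous function on a preconnected set with values in the periods of `exp` is constant. -/
theorem exists_const_of_exp_eq_one {X : Type*} [TopologicalSpace X] {S : Set X} {d : X → ℂ}
    (hS : IsPreconnected S) (hd : ContinuousOn d S) (h1 : ∀ z ∈ S, Complex.exp (d z) = 1) :
    ∃ c, Complex.exp c = 1 ∧ ∀ z ∈ S, d z = c := by
  rcases S.eq_empty_or_nonempty with rfl | ⟨z₀, hz₀⟩
  · exact ⟨0, by simp, by simp⟩
  · refine ⟨d z₀, h1 _ hz₀, fun z hz => ?_⟩
    have hT : DiscreteTopology (AddSubgroup.zmultiples (2 * Real.pi * Complex.I) : Set ℂ) :=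
      NormedSpace.discreteTopology_zmultiples _
    refine hS.constant_of_mapsTo (T := (AddSubgroup.zmultiples (2 * Real.pi * Complex.I) : Set ℂ))
      ⟨hT⟩ hd (fun z hz => ?_) hz hz₀
    obtain ⟨n, hn⟩ := Complex.exp_eq_one_iff.1 (h1 z hz)
    exact AddSubgroup.mem_zmultiples_iff.2 ⟨n, by simp [hn]⟩

/-- The function `f` has a continuous logarithm on `S`. -/
def HasLogOn {X : Type*} [TopologicalSpace X] (f : X → ℂ) (S : Set X) : Prop :=
  ∃ g : X → ℂ, ContinuousOn g S ∧ ∀ z ∈ S, Complex.exp (g z) = f z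

theorem HasLogOn.mono {X : Type*} [TopologicalSpace X] {f : X → ℂ} {S T : Set X}
    (h : HasLogOn f T) (hST : S ⊆ T) : HasLogOn f S := by
  obtain ⟨g, hg, hfg⟩ := h
  exact ⟨g, hg.mono hST, fun z hz => hfg z (hST hz)⟩

theorem HasLogOn.inv {X : Type*} [TopologicalSpace X] {f : X → ℂ} {S : Set X}
    (h : HasLogOn f S) : HasLogOn (fun z => (f z)⁻¹) S := by
  obtain ⟨g, hg, hfg⟩ := h
  exact ⟨fun z => -g z, hg.neg, fun z hz => by rw [Complex.exp_neg, hfg z hz]⟩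

theorem HasLogOn.mul {X : Type*} [TopologicalSpace X] {f₁ f₂ : X → ℂ} {S : Set X}
    (h₁ : HasLogOn f₁ S) (h₂ : HasLogOn f₂ S) : HasLogOn (fun z => f₁ z * f₂ z) S := by
  obtain ⟨g₁, hg₁, hfg₁⟩ := h₁
  obtain ⟨g₂, hg₂, hfg₂⟩ := h₂
  exact ⟨fun z => g₁ z + g₂ z, hg₁.add hg₂, fun z hz => by
    rw [Complex.exp_add, hfg₁ z hz, hfg₂ z hz]⟩

theorem HasLogOn.congr {X : Type*} [TopologicalSpace X] {f₁ f₂ : X → ℂ} {S : Set X}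
    (h₁ : HasLogOn f₁ S) (h : ∀ z ∈ S, f₁ z = f₂ z) : HasLogOn f₂ S := by
  obtain ⟨g₁, hg₁, hfg₁⟩ := h₁
  exact ⟨g₁, hg₁, fun z hz => by rw [hfg₁ z hz, h z hz]⟩

/-- Logarithms on two sets that are both open or both closed can be glued if the intersection of
the sets is preconnected. -/
theorem HasLogOn.union {X : Type*} [TopologicalSpace X] {f : X → ℂ} {A B : Set X}
    (hA : HasLogOn f A) (hB : HasLogOn f B) (hAB : IsPreconnected (A ∩ B))
    (hoc : IsOpen A ∧ IsOpen B ∨ IsClosed A ∧ IsClosed B) : HasLogOn f (A ∪ B) := by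
  classical
  obtain ⟨a, ha, hfa⟩ := hA
  obtain ⟨b, hb, hfb⟩ := hB
  obtain ⟨c, hc, hdc⟩ := exists_const_of_exp_eq_one (d := fun z => a z - b z) hAB
    ((ha.mono inter_subset_left).sub (hb.mono inter_subset_right)) (fun z hz => by
      rw [Complex.exp_sub, hfa z hz.1, hfb z hz.2, div_self]
      rw [← hfa z hz.1]; exact Complex.exp_ne_zero _)
  let g : X → ℂ := fun z => if z ∈ A then a z else b z + c
  have hgA : ∀ z ∈ A, g z = a z := fun z hz => if_pos hz
  have hgB : ∀ z ∈ B, g z = b z + c := fun z hz => by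
    by_cases h : z ∈ A
    · rw [hgA z h, ← hdc z ⟨h, hz⟩]; ring
    · exact if_neg h
  have hcA : ContinuousOn g A := ha.congr hgA
  have hcB : ContinuousOn g B := (hb.add continuousOn_const).congr hgB
  refine ⟨g, ?_, ?_⟩
  · rcases hoc with ⟨h1, h2⟩ | ⟨h1, h2⟩
    · exact hcA.union_of_isOpen hcB h1 h2
    · exact hcA.union_of_isClosed hcB h1 h2
  · rintro z (hz | hz)
    · rw [hgA z hz, hfa z hz]
    · rw [hgB z hz, Complex.exp_add, hc, mul_one, hfb z hz]

/-- The quotient `(z - u) / (z - v)` has a logarithm off any path joining `u` and `v`. -/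
theorem Path.hasLogOn_compl_range {u v : ℂ} (γ : Path u v) :
    HasLogOn (fun z => (z - u) / (z - v)) (range γ)ᶜ := by
  classical
  let A := {z : ℂ // z ∈ (range γ)ᶜ}
  have hne : ∀ (t : unitInterval) (z : A), (z : ℂ) - γ t ≠ 0 := fun t z h =>
    z.2 ⟨t, (sub_eq_zero.1 h).symm⟩
  have hnv : ∀ (z : A), (z : ℂ) - v ≠ 0 := fun z h => hne 1 z (by rw [γ.target]; exact h)
  -- Sliding the numerator's point back along the path from v to u deforms the constant 1 into the
  -- quotient, without zeros off the path. The homotopy lifts through `exp`, starting from the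
  -- logarithm 0 of 1.
  let H : C(unitInterval × A, {z : ℂ // z ≠ 0}) :=
    ⟨fun x => ⟨((x.2 : ℂ) - γ (unitInterval.symm x.1)) / ((x.2 : ℂ) - v),
      div_ne_zero (hne _ _) (hnv _)⟩, by
      refine Continuous.subtype_mk (Continuous.div ?_ ?_ fun x => hnv _) _
      · exact (continuous_subtype_val.comp continuous_snd).sub (by fun_prop)
      · exact (continuous_subtype_val.comp continuous_snd).sub continuous_const⟩
  let L := Complex.isCoveringMap_exp.liftHomotopy H (ContinuousMap.const A 0) (fun z => by
    apply Subtype.ext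
    simp [H, div_self (hnv z)])
  have hL : ∀ t z, Complex.exp (L (t, z)) = (H (t, z) : ℂ) := fun t z =>
    congrArg Subtype.val (congrFun (Complex.isCoveringMap_exp.liftHomotopy_lifts H
      (ContinuousMap.const A 0) _) (t, z))
  refine ⟨fun z => if h : z ∈ (range γ)ᶜ then L (1, ⟨z, h⟩) else 0, ?_, ?_⟩
  · rw [continuousOn_iff_continuous_domRestrict]
    have : ((range γ)ᶜ).domRestrict (fun z => if h : z ∈ (range γ)ᶜ then L (1, ⟨z, h⟩) else 0)
        = fun z : A => L (1, z) := by
      funext z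
      have hz : (z : ℂ) ∈ (range γ)ᶜ := z.2
      simp only [domRestrict_apply]
      rw [dif_pos hz]
    rw [this]
    fun_prop
  · intro z hz
    simp only [dif_pos hz]
    rw [hL]
    simp [H]

/-- A nonvanishing continuous function has a logarithm along an injective path. -/
theorem Path.hasLogOn_range {u v : ℂ} (γ : Path u v) (hγ : Function.Injective γ) {f : ℂ → ℂ}
    (hf : ContinuousOn f (range γ)) (h0 : ∀ z ∈ range γ, f z ≠ 0) : HasLogOn f (range γ) := by
  have he : IsClosedEmbedding γ := γ.continuous.isClosedEmbedding hγ
  let e := he.isEmbedding.toHomeomorph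
  -- Parametrised by the path and extended constantly beyond [0, 1], f becomes a nonvanishing
  -- function on the line, which lifts through `exp`. Injectivity lets the lift be carried back to
  -- the range.
  let F : C(ℝ, ℂ) := ⟨fun t => f (γ (projIcc 0 1 zero_le_one t)), by
    refine hf.comp_continuous (f := fun t => γ (projIcc 0 1 zero_le_one t)) ?_ fun t => mem_range_self _
    exact γ.continuous.comp continuous_projIcc⟩
  obtain ⟨g, ⟨-, hg⟩, -⟩ := Complex.isCoveringMapOn_exp.existsUnique_continuousMap_lifts F
    (a₀ := 0) (e₀ := Complex.log (F 0)) (Complex.exp_log (h0 _ (mem_range_self _)))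
    (fun a => h0 _ (mem_range_self _))
  obtain ⟨G, hG⟩ := ContinuousMap.exists_restrict_eq (s := range γ) he.isClosed_range
    ⟨fun z => g (e.symm z : unitInterval), by fun_prop⟩
  refine ⟨G, G.continuous.continuousOn, ?_⟩
  rintro _ ⟨t, rfl⟩
  have h1 : G (γ t) = g (t : ℝ) := by
    have := congrArg (fun k => k ⟨γ t, mem_range_self t⟩) hG
    have h2 : e.symm ⟨γ t, mem_range_self t⟩ = t := by
      rw [Homeomorph.symm_apply_eq]; rfl
    simpa [h2] using this
  rw [h1]
  have := congrFun hg (t : ℝ)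
  simpa [F] using this

/-- The identity centred at `c` has no logarithm on a circle about `c`. -/
theorem not_hasLogOn_sphere {c : ℂ} {r : ℝ} (hr : 0 < r) :
    ¬ HasLogOn (fun z => z - c) (sphere c r) := by
  rintro ⟨g, hg, hfg⟩
  let k : ℝ → ℂ := fun t => c + r * Complex.exp (t * Complex.I)
  have hk : ∀ t, k t ∈ sphere c r := fun t => by
    simp [k, Complex.norm_exp_ofReal_mul_I, abs_of_pos hr]
  have hkc : Continuous k := by fun_prop
  have hr' : (r : ℂ) ≠ 0 := by exact_mod_cast hr.ne'
  -- Along the parametrised circle a logarithm can differ from t i + log r only by a constant.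
  -- Comparing t = 0 with t = 2π, which give the same point, yields 2πi = 0.
  obtain ⟨w, -, hw⟩ := exists_const_of_exp_eq_one (S := univ)
    (d := fun t : ℝ => g (k t) - t * Complex.I - Complex.log r) isPreconnected_univ
    (by
      refine ContinuousOn.sub (ContinuousOn.sub ?_ (by fun_prop)) continuousOn_const
      exact (hg.comp_continuous hkc hk).continuousOn)
    (fun t _ => by
      rw [Complex.exp_sub, Complex.exp_sub, hfg _ (hk t), Complex.exp_log hr']
      have := Complex.exp_ne_zero (t * Complex.I)
      simp only [k]
      field_simp
      ring)
  have h0 := hw 0 trivial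
  have h1 := hw (2 * Real.pi) trivial
  have hkk : k (2 * Real.pi) = k 0 := by simp [k, Complex.exp_two_pi_mul_I]
  rw [hkk] at h1
  rw [← h0] at h1
  have : ((2 * Real.pi : ℝ) : ℂ) * Complex.I = 0 := by
    have h2 := h1
    simp only [Complex.ofReal_zero, zero_mul, sub_zero] at h2
    linear_combination -h2
  simp [Real.pi_ne_zero] at this

end ContinuousLog

/-! ### Separation of the plane by arcs, Jordan curves and theta curves -/

section PlaneSeparation

theorem isPreconnected_setOf_lt_norm {R : ℝ} :
    IsPreconnected {z : ℂ | R < ‖z‖} := by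
  have h : {z : ℂ | R < ‖z‖} =
      (fun x : ℝ × ℝ => (x.1 : ℂ) * Complex.exp (x.2 * Complex.I)) '' (Ioi R ×ˢ univ) := by
    ext z
    simp only [mem_ofPred_eq, mem_image, mem_prod, mem_Ioi, mem_univ, and_true, Prod.exists]
    constructor
    · intro hz
      exact ⟨‖z‖, z.arg, hz, Complex.norm_mul_exp_arg_mul_I z⟩
    · rintro ⟨r, t, hr, rfl⟩
      rw [norm_mul, Complex.norm_exp_ofReal_mul_I, mul_one, Complex.norm_real]
      exact hr.trans_le (le_abs_self r)
  rw [h]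
  refine (isPreconnected_Ioi.prod isPreconnected_univ).image _ ?_
  fun_prop

/-- An unbounded component meets the exterior of the disc, which is connected and misses K.
Consequently there is only one unbounded component. -/
theorem setOf_lt_norm_subset_of_not_isBounded {K : Set ℂ} {R : ℝ}
    (hK : K ⊆ closedBall 0 R) {z : ℂ} (hz : ¬ IsBounded (connectedComponentIn Kᶜ z)) :
    {z : ℂ | R < ‖z‖} ⊆ connectedComponentIn Kᶜ z := by
  have hs : {z : ℂ | R < ‖z‖} ⊆ Kᶜ := fun w hw hwK => by
    have := hK hwK
    simp only [mem_closedBall, dist_zero_right] at this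
    exact absurd hw (not_lt.2 this)
  obtain ⟨w, hw, hwR⟩ : ∃ w ∈ connectedComponentIn Kᶜ z, R < ‖w‖ := by
    by_contra! h
    exact hz ((isBounded_closedBall (x := (0 : ℂ)) (r := R)).subset fun w hw => by
      simpa using h w hw)
  rw [connectedComponentIn_eq hw]
  exact isPreconnected_setOf_lt_norm.subset_connectedComponentIn hwR hs

theorem isPreconnected_union_of_closure {X : Type*} [TopologicalSpace X] {A B : Set X}
    (hA : IsPreconnected A) (hB : IsPreconnected B) (h : (closure A ∩ B).Nonempty) :
    IsPreconnected (A ∪ B) := by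
  obtain ⟨x, hxA, hxB⟩ := h
  have h1 : IsPreconnected (insert x A) :=
    hA.subset_closure (subset_insert _ _) (insert_subset hxA subset_closure)
  have h2 := h1.union x (mem_insert _ _) hxB hB
  rwa [insert_union, insert_eq_of_mem (mem_union_right _ hxB)] at h2

/-- Components are relatively closed: a connected set stays connected when a limit point is
adjoined. -/
theorem closure_connectedComponentIn_inter_subset {X : Type*} [TopologicalSpace X] (F : Set X)
    (z : X) : closure (connectedComponentIn F z) ∩ F ⊆ connectedComponentIn F z := by
  rintro y ⟨hy, hyF⟩
  rcases (connectedComponentIn F z).eq_empty_or_nonempty with h | h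
  · rw [h] at hy; simp at hy
  have hz : z ∈ F := connectedComponentIn_nonempty_iff.1 h
  have h1 : IsPreconnected (insert y (connectedComponentIn F z)) :=
    isPreconnected_connectedComponentIn.subset_closure (subset_insert _ _)
      (insert_subset hy subset_closure)
  exact h1.subset_connectedComponentIn (mem_insert_of_mem _ (mem_connectedComponentIn hz))
    (insert_subset hyF (connectedComponentIn_subset _ _)) (mem_insert _ _)

/-- The quotient `(z - p) / (z - q)` has no logarithm on the frontier of a bounded open set that
contains `p` and not `q`. -/
theorem not_hasLogOn_of_frontier_subset {K U : Set ℂ} {p q : ℂ} (hK : IsClosed K)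
    (hUb : IsBounded U) (hUK : frontier U ⊆ K) (hp : p ∈ U) (hq : q ∉ U)
    (hqK : q ∉ K) : ¬ HasLogOn (fun z => (z - p) / (z - q)) K := by
  classical
  rintro ⟨g, hg, hfg⟩
  obtain ⟨G, hG⟩ := ContinuousMap.exists_restrict_eq hK ⟨K.domRestrict g, hg.domRestrict⟩
  have hGK : ∀ z ∈ K, G z = g z := fun z hz => congrArg (fun k => k ⟨z, hz⟩) hG
  -- On the frontier `exp (G z)` is (z - p) / (z - q), so the two formulas agree there. Each is free
  -- of zeros where it is used, so h has a logarithm on the whole plane; but on a large circle h is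
  -- z - p.
  let h : ℂ → ℂ := fun z => if z ∈ U then (z - q) * Complex.exp (G z) else z - p
  have hc : Continuous h := by
    refine Continuous.if (fun a ha => ?_) (by fun_prop) (by fun_prop)
    have haK : a ∈ K := hUK ha
    rw [hGK a haK, hfg a haK, mul_div_cancel₀]
    intro h0
    exact hqK (sub_eq_zero.1 h0 ▸ haK)
  have h0 : ∀ z, h z ≠ 0 := fun z => by
    by_cases hz : z ∈ U
    · simp only [h, if_pos hz]
      exact mul_ne_zero (fun h1 => hq (sub_eq_zero.1 h1 ▸ hz)) (Complex.exp_ne_zero _)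
    · simp only [h, if_neg hz]
      exact fun h1 => hz (sub_eq_zero.1 h1 ▸ hp)
  obtain ⟨L, ⟨-, hL⟩, -⟩ := Complex.isCoveringMapOn_exp.existsUnique_continuousMap_lifts
    (⟨h, hc⟩ : C(ℂ, ℂ)) (a₀ := 0) (e₀ := Complex.log (h 0)) (Complex.exp_log (h0 _)) h0
  obtain ⟨r, hr, hUr⟩ := hUb.subset_ball_lt 0 p
  refine not_hasLogOn_sphere hr (c := p) ⟨L, L.continuous.continuousOn, fun z hz => ?_⟩
  have hzU : z ∉ U := fun hzU => by
    have := hUr hzU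
    rw [mem_ball, mem_sphere.1 hz] at this
    exact this.false
  have := congrFun hL z
  simpa [h, hzU] using this

/-- Two points off a compact set `K` for which `(z - p) / (z - q)` has a logarithm on `K` are in the
same component of the complement. -/
theorem HasLogOn.mem_connectedComponentIn {K : Set ℂ} (hK : IsCompact K) {p q : ℂ} (hp : p ∉ K)
    (hq : q ∉ K) (h : HasLogOn (fun z => (z - p) / (z - q)) K) :
    q ∈ connectedComponentIn Kᶜ p := by
  by_contra hqp
  have hne : connectedComponentIn Kᶜ p ≠ connectedComponentIn Kᶜ q := fun he =>
    hqp (he ▸ _root_.mem_connectedComponentIn hq)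
  have hpq : p ∉ connectedComponentIn Kᶜ q := fun hpq => hne (connectedComponentIn_eq hpq).symm
  have hfr : ∀ z, frontier (connectedComponentIn Kᶜ z) ⊆ K := fun z y hy => by
    by_contra hyK
    have hyU := closure_connectedComponentIn_inter_subset Kᶜ z ⟨hy.1, hyK⟩
    have := hy.2
    rw [(hK.isClosed.isOpen_compl.connectedComponentIn).interior_eq] at this
    exact this hyU
  by_cases hbp : IsBounded (connectedComponentIn Kᶜ p)
  · exact not_hasLogOn_of_frontier_subset hK.isClosed
      hbp (hfr p) (_root_.mem_connectedComponentIn hp) hqp hq h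
  by_cases hbq : IsBounded (connectedComponentIn Kᶜ q)
  · refine not_hasLogOn_of_frontier_subset hK.isClosed
      hbq (hfr q) (_root_.mem_connectedComponentIn hq) hpq hp (h.inv.congr fun z _ => inv_div _ _)
  -- If neither component is bounded, both contain the exterior of a large disc and hence coincide.
  obtain ⟨R, hR, hKR⟩ := hK.isBounded.subset_closedBall_lt 0 0
  have h1 := setOf_lt_norm_subset_of_not_isBounded hKR hbp
  have h2 := setOf_lt_norm_subset_of_not_isBounded hKR hbq
  have h3 : ((R + 1 : ℝ) : ℂ) ∈ {z : ℂ | R < ‖z‖} := by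
    rw [mem_ofPred_eq, Complex.norm_real, Real.norm_of_nonneg (by linarith)]; linarith
  exact hne ((connectedComponentIn_eq (h1 h3)).trans (connectedComponentIn_eq (h2 h3)).symm)

/-- Points in a common component of the complement of a closed set have a quotient
`(z - p) / (z - q)` with a logarithm on the set. -/
theorem hasLogOn_of_isPreconnected {K T : Set ℂ} (hK : IsClosed K) (hT : IsPreconnected T)
    (hTK : T ⊆ Kᶜ) {p q : ℂ} (hp : p ∈ T) (hq : q ∈ T) :
    HasLogOn (fun z => (z - p) / (z - q)) K := by
  have hU : IsOpen (connectedComponentIn Kᶜ p) := hK.isOpen_compl.connectedComponentIn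
  have hsub := hT.subset_connectedComponentIn hp hTK
  have hc : IsConnected (connectedComponentIn Kᶜ p) := ⟨⟨p, hsub hp⟩,
    isPreconnected_connectedComponentIn⟩
  have hpc := hU.isConnected_iff_isPathConnected.1 hc
  obtain ⟨γ, hγ⟩ := hpc.joinedIn p (hsub hp) q (hsub hq)
  refine γ.hasLogOn_compl_range.mono fun z hz => ?_
  rintro ⟨t, rfl⟩
  exact connectedComponentIn_subset _ _ (hγ t) hz

/-- `S` is a simple arc with ends `x` and `y`. -/
def IsArcBetween (S : Set ℂ) (x y : ℂ) : Prop :=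
  ∃ γ : _root_.Path x y, Function.Injective γ ∧ range γ = S

theorem IsArcBetween.isCompact {S : Set ℂ} {x y : ℂ} (h : IsArcBetween S x y) : IsCompact S := by
  obtain ⟨γ, -, rfl⟩ := h
  exact isCompact_range γ.continuous

theorem IsArcBetween.left_mem {S : Set ℂ} {x y : ℂ} (h : IsArcBetween S x y) : x ∈ S := by
  obtain ⟨γ, -, rfl⟩ := h
  exact ⟨0, γ.source⟩

theorem IsArcBetween.right_mem {S : Set ℂ} {x y : ℂ} (h : IsArcBetween S x y) : y ∈ S := by
  obtain ⟨γ, -, rfl⟩ := h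
  exact ⟨1, γ.target⟩

theorem IsArcBetween.isPreconnected {S : Set ℂ} {x y : ℂ} (h : IsArcBetween S x y) :
    IsPreconnected S := by
  obtain ⟨γ, -, rfl⟩ := h
  exact isPreconnected_range γ.continuous

theorem IsArcBetween.isPreconnected_diff {S : Set ℂ} {x y : ℂ} (h : IsArcBetween S x y) :
    IsPreconnected (S \ {x, y}) := by
  obtain ⟨γ, hγ, rfl⟩ := h
  have : range γ \ {x, y} = γ '' Ioo 0 1 := by
    ext z
    constructor
    · rintro ⟨⟨t, rfl⟩, ht⟩
      simp only [mem_insert_iff, mem_singleton_iff, not_or] at ht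
      refine ⟨t, ⟨lt_of_le_of_ne t.2.1 ?_, lt_of_le_of_ne t.2.2 ?_⟩, rfl⟩
      · rintro h; exact ht.1 ((congrArg γ h.symm).trans γ.source)
      · rintro h; exact ht.2 ((congrArg γ h).trans γ.target)
    · rintro ⟨t, ht, rfl⟩
      refine ⟨mem_range_self t, ?_⟩
      simp only [mem_insert_iff, mem_singleton_iff, not_or]
      refine ⟨fun h => ht.1.ne' (hγ (h.trans γ.source.symm)),
        fun h => ht.2.ne (hγ (h.trans γ.target.symm))⟩
  rw [this]
  exact isPreconnected_Ioo.image _ γ.continuous.continuousOn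

/-- An arc does not separate the plane. -/
theorem IsArcBetween.isPreconnected_compl {S : Set ℂ} {x y : ℂ} (h : IsArcBetween S x y) :
    IsPreconnected Sᶜ := by
  refine isPreconnected_of_forall_pair fun p hp q hq => ⟨connectedComponentIn Sᶜ p,
    connectedComponentIn_subset _ _, mem_connectedComponentIn hp, ?_,
    isPreconnected_connectedComponentIn⟩
  refine HasLogOn.mem_connectedComponentIn h.isCompact hp hq ?_
  obtain ⟨γ, hγ, rfl⟩ := h
  have hne : ∀ w ∈ (range γ)ᶜ, ∀ z ∈ range γ, z - w ≠ 0 := fun w hw z hz h =>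
    hw (sub_eq_zero.1 h ▸ hz)
  refine γ.hasLogOn_range hγ (ContinuousOn.div (by fun_prop) (by fun_prop) (hne q hq)) ?_
  exact fun z hz => div_ne_zero (hne p hp z hz) (hne q hq z hz)

/-- The separation half of the Jordan curve theorem. -/
theorem Path.not_isPreconnected_compl_union {x y : ℂ} (γ₁ γ₂ : Path x y) (hxy : x ≠ y)
    (h : range γ₁ ∩ range γ₂ ⊆ {x, y}) : ¬ IsPreconnected (range γ₁ ∪ range γ₂)ᶜ := by
  intro hc
  -- Were the complement of the curve connected, the logarithms off the two arcs would glue to one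
  -- off their intersection, which lies in {x, y}. In particular it would be defined on a small
  -- circle about x.
  have h1 := γ₁.hasLogOn_compl_range.union γ₂.hasLogOn_compl_range (by rwa [← compl_union])
    (Or.inl ⟨(isCompact_range γ₁.continuous).isClosed.isOpen_compl,
      (isCompact_range γ₂.continuous).isClosed.isOpen_compl⟩)
  rw [← compl_inter] at h1
  have hd : 0 < ‖x - y‖ := norm_pos_iff.2 (sub_ne_zero.2 hxy)
  have hr : 0 < ‖x - y‖ / 2 := by positivity
  have hxy' : x - y ≠ 0 := sub_ne_zero.2 hxy
  have hsy : ∀ z ∈ sphere x (‖x - y‖ / 2), z - y ≠ 0 := fun z hz h0 => by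
    rw [mem_sphere, dist_eq_norm, sub_eq_zero.1 h0, norm_sub_rev] at hz
    linarith
  have h2 : HasLogOn (fun z => (z - x) / (z - y)) (sphere x (‖x - y‖ / 2)) := by
    refine h1.mono fun z hz hz' => ?_
    rcases h hz' with rfl | hzy
    · rw [mem_sphere, dist_self] at hz; exact hr.ne hz
    · exact hsy z hz (sub_eq_zero.2 hzy)
  have h3 : HasLogOn (fun z => z - y) (sphere x (‖x - y‖ / 2)) := by
    -- The circle has half the radius that would reach y, so (z - y) / (x - y) stays within 1/2 of 1
    -- and the principal logarithm applies. Multiplying by z - y then leaves a forbidden logarithm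
    -- of z - x.
    have hsl : ∀ z ∈ sphere x (‖x - y‖ / 2), (z - y) / (x - y) ∈ Complex.slitPlane :=
      fun z hz => by
        have h5 : (z - y) / (x - y) = 1 + (z - x) / (x - y) := by field_simp; ring
        rw [h5]
        refine Complex.mem_slitPlane_of_norm_lt_one ?_
        rw [norm_div, ← dist_eq_norm z x, mem_sphere.1 hz, div_div, mul_comm, ← div_div,
          div_self hd.ne']
        norm_num
    refine ⟨fun z => Complex.log ((z - y) / (x - y)) + Complex.log (x - y),
      ContinuousOn.add (ContinuousOn.clog (by fun_prop) hsl) continuousOn_const, fun z hz => ?_⟩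
    rw [Complex.exp_add, Complex.exp_log (div_ne_zero (hsy z hz) hxy'), Complex.exp_log hxy',
      div_mul_cancel₀ _ hxy']
  exact not_hasLogOn_sphere hr ((h2.mul h3).congr fun z hz => div_mul_cancel₀ _ (hsy z hz))

/-- A component of the complement of a Jordan curve, assumed disjoint from another nonempty subset
of the complement, touches the interior of each of the two arcs of the curve. -/
theorem closure_connectedComponentIn_inter_nonempty {S₁ S₂ U : Set ℂ} {x y z : ℂ}
    (h₂ : IsArcBetween S₂ x y) (hS : IsClosed (S₁ ∪ S₂)) (hz : z ∈ (S₁ ∪ S₂)ᶜ) (hU : U.Nonempty)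
    (hUS : U ⊆ (S₁ ∪ S₂)ᶜ) (hd : Disjoint U (connectedComponentIn (S₁ ∪ S₂)ᶜ z)) :
    (closure (connectedComponentIn (S₁ ∪ S₂)ᶜ z) ∩ (S₁ \ {x, y})).Nonempty := by
  by_contra hne
  rw [not_nonempty_iff_eq_empty] at hne
  set W := connectedComponentIn (S₁ ∪ S₂)ᶜ z with hW
  have hWo : IsOpen W := hS.isOpen_compl.connectedComponentIn
  have hWS : W ⊆ (S₁ ∪ S₂)ᶜ := connectedComponentIn_subset _ _
  -- If W does not touch the interior of the first arc, it is closed in the complement of the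
  -- second. It is also open, and that complement is connected, so W fills it and cannot miss U.
  have hcl : closure W ∩ S₂ᶜ ⊆ W := by
    rintro w ⟨hw, hw2⟩
    refine closure_connectedComponentIn_inter_subset _ _ ⟨hw, ?_⟩
    rintro (h | h)
    · have : w ∈ closure W ∩ (S₁ \ {x, y}) := ⟨hw, h, by
        rintro (rfl | rfl)
        · exact hw2 h₂.left_mem
        · exact hw2 h₂.right_mem⟩
      rw [hne] at this; exact this
    · exact hw2 h
  have hsub : S₂ᶜ ⊆ W := by
    refine h₂.isPreconnected_compl.subset_of_closure_inter_subset hWo ?_ hcl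
    exact ⟨z, fun h => hz (Or.inr h), mem_connectedComponentIn hz⟩
  obtain ⟨t, ht⟩ := hU
  exact disjoint_left.1 hd ht (hsub fun h => hUS ht (Or.inr h))

/-- A connected set disjoint from a theta curve does not touch the interiors of all three of its
arcs. -/
theorem theta_curve {S₁ S₂ S₃ F : Set ℂ} {x y : ℂ} (hxy : x ≠ y) (h₁ : IsArcBetween S₁ x y)
    (h₂ : IsArcBetween S₂ x y) (h₃ : IsArcBetween S₃ x y) (h₁₂ : S₁ ∩ S₂ ⊆ {x, y})
    (h₁₃ : S₁ ∩ S₃ ⊆ {x, y}) (h₂₃ : S₂ ∩ S₃ ⊆ {x, y}) (hF : IsPreconnected F)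
    (hd : Disjoint F (S₁ ∪ S₂ ∪ S₃)) (hF₁ : (closure F ∩ (S₁ \ {x, y})).Nonempty)
    (hF₂ : (closure F ∩ (S₂ \ {x, y})).Nonempty) (hF₃ : (closure F ∩ (S₃ \ {x, y})).Nonempty) :
    False := by
  have hFS : ∀ z ∈ F, z ∉ S₁ ∧ z ∉ S₂ ∧ z ∉ S₃ := fun z hz => by
    have := disjoint_left.1 hd hz
    simp only [mem_union, not_or] at this
    exact ⟨this.1.1, this.1.2, this.2⟩
  have hclosed : IsClosed (S₁ ∪ S₂) := h₁.isCompact.isClosed.union h₂.isCompact.isClosed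
  have hFne : F.Nonempty := by
    obtain ⟨z, hz, -⟩ := hF₁
    exact closure_nonempty_iff.1 ⟨z, hz⟩
  obtain ⟨b, hb⟩ := hFne
  -- F together with the interior of the third arc lies on one side of the Jordan curve formed by
  -- the other two. The point p is taken from another side, W, which therefore misses the third arc.
  set T := F ∪ (S₃ \ {x, y}) with hTdef
  have hT : IsPreconnected T := isPreconnected_union_of_closure hF h₃.isPreconnected_diff hF₃
  have hTS : T ⊆ (S₁ ∪ S₂)ᶜ := by
    rintro z (hz | ⟨hz3, hz⟩) (h | h)
    · exact (hFS z hz).1 h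
    · exact (hFS z hz).2.1 h
    · exact hz (h₁₃ ⟨h, hz3⟩)
    · exact hz (h₂₃ ⟨h, hz3⟩)
  have hTU : T ⊆ connectedComponentIn (S₁ ∪ S₂)ᶜ b :=
    hT.subset_connectedComponentIn (Or.inl hb) hTS
  obtain ⟨p, hpS, hpb⟩ : ∃ p ∈ (S₁ ∪ S₂)ᶜ, p ∉ connectedComponentIn (S₁ ∪ S₂)ᶜ b := by
    by_contra! hall
    obtain ⟨γ₁, -, rfl⟩ := h₁
    obtain ⟨γ₂, -, rfl⟩ := h₂
    refine γ₁.not_isPreconnected_compl_union γ₂ hxy h₁₂ ?_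
    rw [(connectedComponentIn_subset _ _).antisymm' hall]
    exact isPreconnected_connectedComponentIn
  set W := connectedComponentIn (S₁ ∪ S₂)ᶜ p with hW
  have hpW : p ∈ W := mem_connectedComponentIn hpS
  have hWS : W ⊆ (S₁ ∪ S₂)ᶜ := connectedComponentIn_subset _ _
  have hWd : Disjoint T W := by
    refine disjoint_left.2 fun z hz hzW => hpb ?_
    rw [connectedComponentIn_eq (hTU hz), ← connectedComponentIn_eq hzW]
    exact hpW
  have hW1 := closure_connectedComponentIn_inter_nonempty h₂ hclosed hpS ⟨b, Or.inl hb⟩ hTS hWd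
  have hW2 := closure_connectedComponentIn_inter_nonempty (S₁ := S₂) h₁ (by rwa [union_comm])
    (by rwa [union_comm]) (U := T) ⟨b, Or.inl hb⟩ (by rwa [union_comm])
    (by rw [union_comm S₂ S₁]; exact hWd)
  rw [union_comm S₂ S₁, ← hW] at hW2
  have hW3 : ∀ z ∈ W, z ∉ S₃ := fun z hz h => by
    refine disjoint_left.1 hWd (show z ∈ T from Or.inr ⟨h, ?_⟩) hz
    rintro (rfl | rfl)
    · exact hWS hz (Or.inl h₁.left_mem)
    · exact hWS hz (Or.inl h₁.right_mem)
  -- Both W and F touch the interior of A, so the three together form a connected set that joins p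
  -- to b off the other two arcs.
  have key : ∀ {A B : Set ℂ}, IsArcBetween A x y → IsArcBetween B x y → A ∩ B ⊆ {x, y} →
      A ∩ S₃ ⊆ {x, y} → W ⊆ Bᶜ → F ⊆ Bᶜ →
      (closure F ∩ (A \ {x, y})).Nonempty → (closure W ∩ (A \ {x, y})).Nonempty →
      HasLogOn (fun z => (z - p) / (z - b)) (B ∪ S₃) := by
    intro A B hA hB hAB hA3 hWB hFB hFA hWA
    have c1 := isPreconnected_union_of_closure isPreconnected_connectedComponentIn
      hA.isPreconnected_diff hWA
    have c2 := isPreconnected_union_of_closure hF hA.isPreconnected_diff hFA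
    obtain ⟨w, -, hw⟩ := hFA
    refine hasLogOn_of_isPreconnected (hB.isCompact.isClosed.union h₃.isCompact.isClosed)
      (c1.union w (Or.inr hw) (Or.inr hw) c2) ?_ (Or.inl (Or.inl hpW)) (Or.inr (Or.inl hb))
    rintro z ((hz | hz) | (hz | hz)) (h | h)
    · exact hWB hz h
    · exact hW3 z hz h
    · exact hz.2 (hAB ⟨hz.1, h⟩)
    · exact hz.2 (hA3 ⟨hz.1, h⟩)
    · exact hFB hz h
    · exact (hFS z hz).2.2 h
    · exact hz.2 (hAB ⟨hz.1, h⟩)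
    · exact hz.2 (hA3 ⟨hz.1, h⟩)
  have l1 := key h₁ h₂ h₁₂ h₁₃ (fun z hz h => hWS hz (Or.inr h)) (fun z hz => (hFS z hz).2.1)
    hF₁ hW1
  have l2 := key h₂ h₁ (by rwa [inter_comm]) h₂₃ (fun z hz h => hWS hz (Or.inl h))
    (fun z hz => (hFS z hz).1) hF₂ (by rwa [pair_comm, pair_comm y x] at hW2)
  have hint : (S₂ ∪ S₃) ∩ (S₁ ∪ S₃) = S₃ := by
    ext z
    constructor
    · rintro ⟨h2 | h2, h1 | h1⟩ <;> try assumption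
      rcases h₁₂ ⟨h1, h2⟩ with rfl | rfl
      · exact h₃.left_mem
      · exact h₃.right_mem
    · exact fun h => ⟨Or.inr h, Or.inr h⟩
  -- The two logarithms live on closed sets whose intersection is the connected third arc, so they
  -- glue to one on the whole theta curve. This puts p and b into the same component, against the
  -- choice of p.
  have l3 := l1.union l2 (by rw [hint]; exact h₃.isPreconnected)
    (Or.inr ⟨h₂.isCompact.isClosed.union h₃.isCompact.isClosed,
      h₁.isCompact.isClosed.union h₃.isCompact.isClosed⟩)
  have hpθ : p ∉ S₂ ∪ S₃ ∪ (S₁ ∪ S₃) := by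
    rintro ((h | h) | (h | h))
    · exact hpS (Or.inr h)
    · exact hW3 p hpW h
    · exact hpS (Or.inl h)
    · exact hW3 p hpW h
  have hbθ : b ∉ S₂ ∪ S₃ ∪ (S₁ ∪ S₃) := by
    rintro ((h | h) | (h | h))
    · exact (hFS b hb).2.1 h
    · exact (hFS b hb).2.2 h
    · exact (hFS b hb).1 h
    · exact (hFS b hb).2.2 h
  have := HasLogOn.mem_connectedComponentIn ((h₂.isCompact.union h₃.isCompact).union
    (h₁.isCompact.union h₃.isCompact)) hpθ hbθ l3
  have hbW : b ∈ W := connectedComponentIn_mono p (compl_subset_compl.2 (by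
    rintro z (h | h)
    · exact Or.inr (Or.inl h)
    · exact Or.inl (Or.inl h))) this
  exact disjoint_left.1 hWd (Or.inl hb) hbW

end PlaneSeparation

/-! ### Concatenation of simple arcs -/

section ArcConcatenation

theorem Path.trans_injective {X : Type*} [TopologicalSpace X] {x y z : X} (γ₁ : Path x y)
    (γ₂ : Path y z) (h₁ : Function.Injective γ₁) (h₂ : Function.Injective γ₂)
    (h : range γ₁ ∩ range γ₂ ⊆ {y}) : Function.Injective (γ₁.trans γ₂) := by
  have key : ∀ s t : unitInterval, (s : ℝ) ≤ 1 / 2 → ¬ (t : ℝ) ≤ 1 / 2 →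
      (γ₁.trans γ₂) s ≠ (γ₁.trans γ₂) t := by
    intro s t hs ht heq
    rw [Path.trans_apply, Path.trans_apply, dif_pos hs, dif_neg ht] at heq
    have hy := h ⟨⟨_, heq⟩, mem_range_self _⟩
    have := h₂ ((mem_singleton_iff.1 hy).trans γ₂.source.symm)
    have := congrArg Subtype.val this
    simp only [Set.Icc.coe_zero] at this
    linarith
  intro s t hst
  by_cases hs : (s : ℝ) ≤ 1 / 2 <;> by_cases ht : (t : ℝ) ≤ 1 / 2
  · rw [Path.trans_apply, Path.trans_apply, dif_pos hs, dif_pos ht] at hst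
    have := congrArg Subtype.val (h₁ hst)
    simp only at this
    exact Subtype.ext (by linarith)
  · exact absurd hst (key s t hs ht)
  · exact absurd hst.symm (key t s ht hs)
  · rw [Path.trans_apply, Path.trans_apply, dif_neg hs, dif_neg ht] at hst
    have := congrArg Subtype.val (h₂ hst)
    simp only at this
    exact Subtype.ext (by linarith)

theorem IsArcBetween.union {S T : Set ℂ} {x y z : ℂ} (h₁ : IsArcBetween S x y)
    (h₂ : IsArcBetween T y z) (h : S ∩ T ⊆ {y}) : IsArcBetween (S ∪ T) x z := by
  obtain ⟨γ₁, i₁, rfl⟩ := h₁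
  obtain ⟨γ₂, i₂, rfl⟩ := h₂
  exact ⟨γ₁.trans γ₂, γ₁.trans_injective γ₂ i₁ i₂ h, γ₁.trans_range γ₂⟩

end ArcConcatenation

/-! ### Outerplanar drawings contain no thetas -/

namespace SimpleGraph

variable {V : Type u} {G : SimpleGraph V}

/-- The points of a drawing that lie on the arcs of the edges of a walk. -/
def PlaneEmbedding.walkSet (E : G.PlaneEmbedding) {x y : V} (p : G.Walk x y) : Set ℂ :=
  {z | ∃ e : G.edgeSet, (e : Sym2 V) ∈ p.edges ∧ z ∈ E.arc e}

/-- The first arc meets the later ones only in images of common vertices, and a path never returns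
to its start, so the arcs concatenate to a simple arc. The trivial path is excluded because it has
no edges and its point set is empty. -/
theorem PlaneEmbedding.isArcBetween_walkSet (E : G.PlaneEmbedding) {x y : V} (p : G.Walk x y)
    (hp : p.IsPath) (hn : ¬ p.Nil) : IsArcBetween (E.walkSet p) (E.pos x) (E.pos y) := by
  induction p with
  | nil => simp at hn
  | @cons x v y h p ih =>
    have h1 : IsArcBetween (E.arc ⟨s(x, v), h⟩) (E.pos x) (E.pos v) := E.arc_spec x v h
    rw [Walk.cons_isPath_iff] at hp
    by_cases hnil : p.Nil
    · cases hnil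
      convert h1 using 1
      ext z
      constructor
      · rintro ⟨⟨e, he⟩, hep, hz⟩
        simp only [Walk.edges_cons, Walk.edges_nil, List.mem_singleton] at hep
        subst hep
        exact hz
      · exact fun hz => ⟨_, by simp, hz⟩
    · have hset : E.walkSet (Walk.cons h p) = E.arc ⟨s(x, v), h⟩ ∪ E.walkSet p := by
        ext z
        constructor
        · rintro ⟨⟨e, he⟩, hep, hz⟩
          simp only [Walk.edges_cons, List.mem_cons] at hep
          rcases hep with rfl | hep
          · exact Or.inl hz
          · exact Or.inr ⟨⟨e, he⟩, hep, hz⟩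
        · rintro (hz | ⟨e, hep, hz⟩)
          · exact ⟨_, by simp, hz⟩
          · exact ⟨e, by simp [hep], hz⟩
      rw [hset]
      refine h1.union (ih hp.1 hnil) ?_
      rintro z ⟨hz1, e, hep, hz2⟩
      have hne : (⟨s(x, v), h⟩ : G.edgeSet) ≠ e := by
        rintro rfl
        exact hp.2 (p.fst_mem_support_of_mem_edges hep)
      obtain ⟨w, ⟨hw1, hw2⟩, rfl⟩ := E.arc_inter_arc _ _ hne ⟨hz1, hz2⟩
      have hws : w ∈ p.support := p.mem_support_of_mem_edges hep hw2
      rcases Sym2.mem_iff.1 hw1 with rfl | rfl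
      · exact absurd hws hp.2
      · rfl

theorem Walk.IsPath.not_mem_edges_of_two_le_length {x y : V} {p : G.Walk x y} (hp : p.IsPath)
    (hl : 2 ≤ p.length) : s(x, y) ∉ p.edges := by
  cases p with
  | nil => simp
  | @cons _ v _ h q =>
    rw [Walk.cons_isPath_iff] at hp
    intro hmem
    simp only [Walk.edges_cons, List.mem_cons] at hmem
    rcases hmem with heq | hmem
    · have hyv : y = v := Sym2.congr_right.1 heq
      subst hyv
      have := (Walk.isPath_iff_nil.1 hp.1).length_eq_zero
      simp [this] at hl
    · exact hp.2 (q.fst_mem_support_of_mem_edges hmem)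

/-- A shared edge would have both ends in {x, y}, but a path of length at least 2 from x to y does
not use the edge xy. Distinct edges meet only in common vertices. -/
theorem PlaneEmbedding.walkSet_inter_subset (E : G.PlaneEmbedding) {x y : V} {p q : G.Walk x y}
    (hp : p.IsPath) (hl : 2 ≤ p.length) (hpq : ∀ w ∈ p.support, w ∈ q.support → w = x ∨ w = y) :
    E.walkSet p ∩ E.walkSet q ⊆ {E.pos x, E.pos y} := by
  rintro z ⟨⟨e, he, hze⟩, f, hf, hzf⟩
  by_cases hef : e = f
  · subst hef
    obtain ⟨e, heG⟩ := e
    induction e using Sym2.inductionOn with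
    | _ a b =>
      simp only at he hf
      have ha := hpq a (p.fst_mem_support_of_mem_edges he) (q.fst_mem_support_of_mem_edges hf)
      have hb := hpq b (p.snd_mem_support_of_mem_edges he) (q.snd_mem_support_of_mem_edges hf)
      have hab : a ≠ b := G.ne_of_adj heG
      have := hp.not_mem_edges_of_two_le_length hl
      rcases ha with rfl | rfl <;> rcases hb with rfl | rfl
      · exact absurd rfl hab
      · exact absurd he this
      · rw [Sym2.eq_swap] at he; exact absurd he this
      · exact absurd rfl hab
  · obtain ⟨w, ⟨hw1, hw2⟩, rfl⟩ := E.arc_inter_arc _ _ hef ⟨hze, hzf⟩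
    rcases hpq w (p.mem_support_of_mem_edges he hw1) (q.mem_support_of_mem_edges hf hw2)
      with rfl | rfl <;> simp

theorem PlaneEmbedding.pos_mem_arc (E : G.PlaneEmbedding) (e : G.edgeSet) {x : V}
    (hx : x ∈ (e : Sym2 V)) : E.pos x ∈ E.arc e := by
  obtain ⟨e, he⟩ := e
  induction e using Sym2.inductionOn with
  | _ a b =>
    have h : IsArcBetween (E.arc ⟨s(a, b), he⟩) (E.pos a) (E.pos b) := E.arc_spec a b he
    rcases Sym2.mem_iff.1 hx with rfl | rfl
    · exact h.left_mem
    · exact h.right_mem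

theorem PlaneEmbedding.pos_mem_walkSet (E : G.PlaneEmbedding) {x y w : V} (p : G.Walk x y)
    (hn : ¬ p.Nil) (hw : w ∈ p.support) : E.pos w ∈ E.walkSet p := by
  obtain ⟨e, he, hwe⟩ := (Walk.mem_support_iff_exists_mem_edges_of_not_nil hn).1 hw
  exact ⟨⟨e, p.edges_subset_edgeSet he⟩, he, E.pos_mem_arc _ hwe⟩

theorem PlaneEmbedding.isCompact_support [Finite V] (E : G.PlaneEmbedding) :
    IsCompact E.support := by
  refine (finite_range E.pos).isCompact.union (isCompact_iUnion fun e => ?_)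
  obtain ⟨e, he⟩ := e
  induction e using Sym2.inductionOn with
  | _ a b =>
    have h : IsArcBetween (E.arc ⟨s(a, b), he⟩) (E.pos a) (E.pos b) := E.arc_spec a b he
    exact h.isCompact

/-- The drawing of a finite graph is compact, so every unbounded component contains the exterior of
one fixed disc. -/
theorem PlaneEmbedding.isPreconnected_outerFace [Finite V] (E : G.PlaneEmbedding) :
    IsPreconnected E.outerFace := by
  obtain ⟨R, -, hKR⟩ := E.isCompact_support.isBounded.subset_closedBall_lt 0 0
  refine isPreconnected_of_forall_pair fun z hz w hw =>
    ⟨connectedComponentIn E.supportᶜ z, fun t ht => ⟨connectedComponentIn_subset _ _ ht, ?_⟩,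
      mem_connectedComponentIn hz.1, ?_, isPreconnected_connectedComponentIn⟩
  · rw [← connectedComponentIn_eq ht]; exact hz.2
  · have h1 := setOf_lt_norm_subset_of_not_isBounded hKR hz.2
    have h2 := setOf_lt_norm_subset_of_not_isBounded hKR hw.2
    have h3 : ((|R| + 1 : ℝ) : ℂ) ∈ {z : ℂ | R < ‖z‖} := by
      rw [mem_ofPred_eq, Complex.norm_real, Real.norm_of_nonneg (by positivity)]
      linarith [le_abs_self R]
    rw [connectedComponentIn_eq (h1 h3), ← connectedComponentIn_eq (h2 h3)]
    exact mem_connectedComponentIn hw.1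

/-- No two vertices are joined through three disjoint connected sets of further vertices. -/
def ThetaFree (G : SimpleGraph V) : Prop :=
  ∀ (x y : V) (S : Fin 3 → Set V), x ≠ y → (∀ i j, i ≠ j → Disjoint (S i) (S j)) →
    (∀ i, x ∉ S i) → (∀ i, y ∉ S i) → (∀ i, (G.induce (S i)).Preconnected) →
    (∀ i, ∃ a ∈ S i, G.Adj x a) → (∀ i, ∃ b ∈ S i, G.Adj b y) → False

theorem Preconnected.exists_isPath_of_induce {S : Set V} (hS : (G.induce S).Preconnected) {a b : V}
    (ha : a ∈ S) (hb : b ∈ S) : ∃ p : G.Walk a b, p.IsPath ∧ ∀ w ∈ p.support, w ∈ S := by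
  classical
  obtain ⟨q⟩ := hS ⟨a, ha⟩ ⟨b, hb⟩
  have hsupp : ∀ w ∈ (q.toPath.1.map (Embedding.induce S).toHom).support, w ∈ S := fun w hw => by
    rw [Walk.support_map, List.mem_map] at hw
    obtain ⟨w', -, rfl⟩ := hw
    exact w'.2
  exact ⟨_, q.toPath.2.map (f := (Embedding.induce S).toHom) Subtype.val_injective, hsupp⟩

/-- A path between two vertices through a connected set of vertices. -/
theorem exists_isPath_through {S : Set V} {x y a b : V} (hxy : x ≠ y) (hx : x ∉ S) (hy : y ∉ S)
    (hS : (G.induce S).Preconnected) (ha : a ∈ S) (hxa : G.Adj x a) (hb : b ∈ S)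
    (hby : G.Adj b y) :
    ∃ p : G.Walk x y, p.IsPath ∧ 2 ≤ p.length ∧ a ∈ p.support ∧
      ∀ w ∈ p.support, w = x ∨ w = y ∨ w ∈ S := by
  obtain ⟨r, hr, hrS⟩ := hS.exists_isPath_of_induce ha hb
  refine ⟨Walk.cons hxa (r.concat hby), ?_, ?_, ?_, ?_⟩
  · rw [Walk.cons_isPath_iff, Walk.concat_isPath_iff]
    refine ⟨⟨hr, fun h => hy (hrS _ h)⟩, ?_⟩
    rw [Walk.support_concat]
    simp only [List.mem_append, List.mem_singleton, not_or]
    exact ⟨fun h => hx (hrS _ h), hxy⟩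
  · simp
  · simp only [Walk.support_cons, Walk.support_concat, List.mem_cons, List.mem_append]
    exact Or.inr (Or.inl r.start_mem_support)
  · intro w hw
    rw [Walk.support_cons, Walk.support_concat] at hw
    simp only [List.mem_cons, List.mem_append, List.not_mem_nil, or_false] at hw
    rcases hw with h | h | h
    · exact Or.inl h
    · exact Or.inr (Or.inr (hrS _ h))
    · exact Or.inr (Or.inl h)

/-- Paths through the three sets are drawn as a theta curve. On each, the neighbour of x is a vertex
interior to the arc and lies in the closure of the outer face, which contradicts `theta_curve`. -/
theorem IsOuterplanar.thetaFree [Finite V] (h : G.IsOuterplanar) : G.ThetaFree := by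
  obtain ⟨E, hE⟩ := h
  intro x y S hxy hd hx hy hS ha hb
  choose a haS hxa using ha
  choose b hbS hby using hb
  choose p hp hl hap hsupp using fun i =>
    exists_isPath_through hxy (hx i) (hy i) (hS i) (haS i) (hxa i) (hbS i) (hby i)
  have hnil : ∀ i, ¬ (p i).Nil := fun i hn => by
    have := hn.length_eq_zero
    have := hl i
    omega
  have harc := fun i => E.isArcBetween_walkSet (p i) (hp i) (hnil i)
  have hint : ∀ i j, i ≠ j → E.walkSet (p i) ∩ E.walkSet (p j) ⊆ {E.pos x, E.pos y} := by
    intro i j hij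
    refine E.walkSet_inter_subset (hp i) (hl i) fun w hwi hwj => ?_
    rcases hsupp i w hwi with h | h | h
    · exact Or.inl h
    · exact Or.inr h
    rcases hsupp j w hwj with h' | h' | h'
    · exact Or.inl h'
    · exact Or.inr h'
    exact absurd h' (Set.disjoint_left.1 (hd i j hij) h)
  have hcl : ∀ i, (closure E.outerFace ∩ (E.walkSet (p i) \ {E.pos x, E.pos y})).Nonempty := by
    intro i
    refine ⟨E.pos (a i), (hE (a i)).1, E.pos_mem_walkSet _ (hnil i) (hap i), ?_⟩
    simp only [mem_insert_iff, mem_singleton_iff, E.pos_injective.eq_iff, not_or]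
    exact ⟨fun h => hx i (h ▸ haS i), fun h => hy i (h ▸ haS i)⟩
  have hsub : ∀ i, E.walkSet (p i) ⊆ E.support := by
    rintro i z ⟨e, -, hz⟩
    exact Or.inr (mem_iUnion.2 ⟨e, hz⟩)
  refine theta_curve (E.pos_injective.ne hxy) (harc 0) (harc 1) (harc 2) (hint 0 1 (by decide))
    (hint 0 2 (by decide)) (hint 1 2 (by decide)) E.isPreconnected_outerFace
    (Set.disjoint_left.2 fun z hz hz' => ?_) (hcl 0) (hcl 1) (hcl 2)
  rcases hz' with (h | h) | h
  · exact hz.1 (hsub 0 h)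
  · exact hz.1 (hsub 1 h)
  · exact hz.1 (hsub 2 h)

/-- Outerplanarity passes to subgraphs. -/
theorem IsOuterplanar.of_injective_hom {W : Type v} {H : SimpleGraph W} (h : G.IsOuterplanar)
    (f : H →g G) (hf : Function.Injective f) : H.IsOuterplanar := by
  obtain ⟨E, hE⟩ := h
  have hinj : Function.Injective (Sym2.map f) := Sym2.map.injective hf
  let E' : H.PlaneEmbedding :=
    { pos := fun x => E.pos (f x)
      arc := fun e => E.arc (f.mapEdgeSet e)
      pos_injective := E.pos_injective.comp hf
      arc_spec := fun x y hxy => E.arc_spec (f x) (f y) (f.map_adj hxy)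
      mem_of_pos_mem_arc := fun e x hx => by
        obtain ⟨y, hy, hxy⟩ := Sym2.mem_map.1 (E.mem_of_pos_mem_arc _ _ hx)
        exact hf hxy ▸ hy
      arc_inter_arc := fun e e' hne z hz => by
        have hne' : f.mapEdgeSet e ≠ f.mapEdgeSet e' := fun h =>
          hne (Subtype.ext (hinj (congrArg Subtype.val h)))
        obtain ⟨x, ⟨hx, hx'⟩, rfl⟩ := E.arc_inter_arc _ _ hne' hz
        obtain ⟨y, hy, rfl⟩ := Sym2.mem_map.1 hx
        obtain ⟨y', hy', hyy⟩ := Sym2.mem_map.1 hx'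
        exact ⟨y, ⟨hy, hf hyy ▸ hy'⟩, rfl⟩ }
  have hsub : E'.support ⊆ E.support := by
    rintro z (⟨x, rfl⟩ | hz)
    · exact Or.inl ⟨_, rfl⟩
    · obtain ⟨e, he⟩ := mem_iUnion.1 hz
      exact Or.inr (mem_iUnion.2 ⟨_, he⟩)
  -- Erasing part of a drawing only enlarges the components of its complement, so unbounded ones
  -- remain unbounded.
  have hface : E.outerFace ⊆ E'.outerFace := fun z hz =>
    ⟨fun h => hz.1 (hsub h), fun hb => hz.2 (hb.subset
      (connectedComponentIn_mono z (compl_subset_compl.2 hsub)))⟩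
  refine ⟨E', fun x => ⟨closure_mono hface (hE (f x)).1, fun hx => ?_⟩⟩
  exact (interior_subset hx).1 (Or.inl ⟨x, rfl⟩)

end SimpleGraph

namespace SimpleGraph

variable {V : Type u} {G : SimpleGraph V}

/-! ### Straight-line drawings on a parabola -/

section Parabola

/-- The points of the chord of the parabola `y = x ^ 2` over the interval from `a` to `b`. -/
def parabolaChord (a b : ℝ) : Set ℂ :=
  {z | a ≤ z.re ∧ z.re ≤ b ∧ z.im = (a + b) * z.re - a * b}

/-- A chord set whose first end exceeds its second is empty, so the union over both orders is the
segment, whichever end is smaller. -/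
theorem isArcBetween_parabolaChord {a b : ℝ} (hab : a ≠ b) :
    IsArcBetween (parabolaChord a b ∪ parabolaChord b a) ⟨a, a ^ 2⟩ ⟨b, b ^ 2⟩ := by
  let f : unitInterval → ℂ := fun t =>
    ((a + t * (b - a) : ℝ) : ℂ) + (((a + b) * (a + t * (b - a)) - a * b : ℝ) : ℂ) * Complex.I
  have hre : ∀ t, (f t).re = a + t * (b - a) := fun t => by
    simp only [f, Complex.add_re, Complex.mul_re, Complex.ofReal_re, Complex.ofReal_im,
      Complex.I_re, Complex.I_im]; ring
  have him : ∀ t, (f t).im = (a + b) * (a + t * (b - a)) - a * b := fun t => by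
    simp only [f, Complex.add_im, Complex.mul_im, Complex.ofReal_re, Complex.ofReal_im,
      Complex.I_re, Complex.I_im]; ring
  refine ⟨⟨⟨f, by fun_prop⟩, ?_, ?_⟩, ?_, ?_⟩
  · apply Complex.ext
    · rw [hre]; simp
    · rw [him]; simp; ring
  · apply Complex.ext
    · rw [hre]; simp
    · rw [him]; simp; ring
  · intro s t hst
    have h1 : (f s).re = (f t).re := congrArg Complex.re hst
    rw [hre, hre] at h1
    have h2 : ((s : ℝ) - t) * (b - a) = 0 := by linarith
    rcases mul_eq_zero.1 h2 with h | h
    · exact Subtype.ext (by linarith)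
    · exact absurd (by linarith) hab
  · ext z
    constructor
    · rintro ⟨t, rfl⟩
      change f t ∈ _
      have t0 := t.2.1
      have t1 := t.2.2
      rcases lt_or_gt_of_ne hab with h | h
      · refine Or.inl ⟨?_, ?_, ?_⟩
        · rw [hre]; nlinarith
        · rw [hre]; nlinarith
        · rw [hre, him]
      · refine Or.inr ⟨?_, ?_, ?_⟩
        · rw [hre]; nlinarith
        · rw [hre]; nlinarith
        · rw [hre, him]; ring
    · intro hz
      have hba : b - a ≠ 0 := sub_ne_zero.2 hab.symm
      have h01 : (z.re - a) / (b - a) ∈ unitInterval := by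
        rcases hz with ⟨h1, h2, -⟩ | ⟨h1, h2, -⟩
        · have : 0 < b - a := lt_of_le_of_ne (by linarith) hba.symm
          exact ⟨div_nonneg (by linarith) this.le, (div_le_one this).2 (by linarith)⟩
        · have : b - a < 0 := lt_of_le_of_ne (by linarith) hba
          exact ⟨div_nonneg_of_nonpos (by linarith) this.le,
            (div_le_one_of_neg this).2 (by linarith)⟩
      have him' : z.im = (a + b) * z.re - a * b := by
        rcases hz with ⟨-, -, h⟩ | ⟨-, -, h⟩
        · exact h
        · rw [h]; ring
      refine ⟨⟨_, h01⟩, ?_⟩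
      change f _ = z
      have hx : a + (z.re - a) / (b - a) * (b - a) = z.re := by
        rw [div_mul_cancel₀ _ hba]; ring
      apply Complex.ext
      · rw [hre]; exact hx
      · rw [him, him']
        simp only [hx]

/-- At abscissa t the chord over [a, b] lies (t - a)(b - t) above the parabola. Distinct noncrossing
intervals that overlap are nested, and there the larger interval gives a strictly larger height. So
a common point has height 0, which makes it an end of both chords. -/
theorem parabolaChord_inter {a b c d : ℕ} {z : ℂ}
    (h₁ : z ∈ parabolaChord a b) (h₂ : z ∈ parabolaChord c d) (hne : ¬ (a = c ∧ b = d))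
    (hac : ¬ (a < c ∧ c < b ∧ b < d)) (hca : ¬ (c < a ∧ a < d ∧ d < b)) :
    ∃ e : ℕ, (e = a ∨ e = b) ∧ (e = c ∨ e = d) ∧ z = ⟨(e : ℝ), (e : ℝ) ^ 2⟩ := by
  obtain ⟨a1, b1, i1⟩ := h₁
  obtain ⟨c1, d1, i2⟩ := h₂
  have heq : (z.re - a) * (b - z.re) = (z.re - c) * (d - z.re) := by linarith
  have him : z.im = z.re ^ 2 + (z.re - a) * (b - z.re) := by rw [i1]; ring
  have main : (z.re - a) * (b - z.re) = 0 := by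
    by_contra h0
    have ha : (a : ℝ) < z.re := lt_of_le_of_ne a1 (by rintro h; apply h0; rw [← h]; ring)
    have hb : z.re < (b : ℝ) := lt_of_le_of_ne b1 (by rintro h; apply h0; rw [← h]; ring)
    rw [heq] at h0
    have hc : (c : ℝ) < z.re := lt_of_le_of_ne c1 (by rintro h; apply h0; rw [← h]; ring)
    have hd : z.re < (d : ℝ) := lt_of_le_of_ne d1 (by rintro h; apply h0; rw [← h]; ring)
    have hcb : c < b := by exact_mod_cast hc.trans hb
    have had : a < d := by exact_mod_cast ha.trans hd
    rcases lt_trichotomy a c with h | h | h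
    · have hdb : (d : ℝ) ≤ b := by
        have : d ≤ b := not_lt.1 fun h' => hac ⟨h, hcb, h'⟩
        exact_mod_cast this
      have hac' : (a : ℝ) < c := by exact_mod_cast h
      nlinarith [mul_pos (sub_pos.2 hac') (sub_pos.2 hb)]
    · subst h
      have h3 : (z.re - a) * ((b : ℝ) - d) = 0 := by linarith
      rcases mul_eq_zero.1 h3 with h3 | h3
      · linarith
      · exact hne ⟨rfl, by exact_mod_cast sub_eq_zero.1 h3⟩
    · have hbd : (b : ℝ) ≤ d := by
        have : b ≤ d := not_lt.1 fun h' => hca ⟨h, had, h'⟩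
        exact_mod_cast this
      have hac' : (c : ℝ) < a := by exact_mod_cast h
      nlinarith [mul_pos (sub_pos.2 hac') (sub_pos.2 hd)]
  rw [main, add_zero] at him
  rw [main] at heq
  have e1 : z.re = a ∨ z.re = b := by
    rcases mul_eq_zero.1 main with h | h
    · left; linarith
    · right; linarith
  have e2 : z.re = c ∨ z.re = d := by
    rcases mul_eq_zero.1 heq.symm with h | h
    · left; linarith
    · right; linarith
  have key : ∀ e : ℕ, z.re = e → z = ⟨(e : ℝ), (e : ℝ) ^ 2⟩ := fun e he => by
    apply Complex.ext
    · exact he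
    · rw [him, he]
  rcases e1 with h | h
  · refine ⟨a, Or.inl rfl, ?_, key a h⟩
    rw [h] at e2; exact_mod_cast e2
  · refine ⟨b, Or.inr rfl, ?_, key b h⟩
    rw [h] at e2; exact_mod_cast e2

theorem sq_re_le_im_of_mem_parabolaChord {a b : ℝ} {z : ℂ} (h : z ∈ parabolaChord a b) :
    z.re ^ 2 ≤ z.im := by
  obtain ⟨h1, h2, h3⟩ := h
  nlinarith [mul_nonneg (sub_nonneg.2 h1) (sub_nonneg.2 h2)]

/-- The straight-line drawing of a graph with vertices on a parabola, for an order of the vertices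
in which no two edges cross. -/
def parabolaEmbedding (idx : V → ℕ) (hidx : Function.Injective idx)
    (hcross : ∀ x y z w, G.Adj x y → G.Adj z w →
      ¬ (idx x < idx z ∧ idx z < idx y ∧ idx y < idx w)) : G.PlaneEmbedding where
  pos x := ⟨idx x, (idx x : ℝ) ^ 2⟩
  arc e := {z | ∃ x y, (e : Sym2 V) = s(x, y) ∧ z ∈ parabolaChord (idx x) (idx y)}
  pos_injective x y h := by
    have := congrArg Complex.re h
    simp only [Nat.cast_inj] at this
    exact hidx this
  arc_spec x y h := by
    have hne : (idx x : ℝ) ≠ idx y := by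
      have := hidx.ne (G.ne_of_adj h)
      exact_mod_cast this
    have := isArcBetween_parabolaChord hne
    have hset : {z : ℂ | ∃ a b, s(x, y) = s(a, b) ∧ z ∈ parabolaChord (idx a) (idx b)} =
        parabolaChord (idx x) (idx y) ∪ parabolaChord (idx y) (idx x) := by
      ext z
      constructor
      · rintro ⟨a, b, hab, hz⟩
        rcases Sym2.eq_iff.1 hab with ⟨rfl, rfl⟩ | ⟨rfl, rfl⟩
        · exact Or.inl hz
        · exact Or.inr hz
      · rintro (hz | hz)
        · exact ⟨x, y, rfl, hz⟩
        · exact ⟨y, x, Sym2.eq_swap, hz⟩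
    rw [← hset] at this
    exact this
  mem_of_pos_mem_arc := by
    rintro e w ⟨x, y, he, -, -, hz⟩
    simp only at hz
    have : ((idx w : ℝ) - idx x) * (idx w - idx y) = 0 := by linarith
    rw [he]
    rcases mul_eq_zero.1 this with h | h
    · have : idx w = idx x := by exact_mod_cast sub_eq_zero.1 h
      rw [hidx this]; simp
    · have : idx w = idx y := by exact_mod_cast sub_eq_zero.1 h
      rw [hidx this]; simp
  arc_inter_arc := by
    rintro ⟨e, he⟩ ⟨f, hf⟩ hne z ⟨⟨x, y, hxy, hz1⟩, ⟨x', y', hxy', hz2⟩⟩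
    simp only at hxy hxy'
    subst hxy hxy'
    obtain ⟨i, hi, hi', rfl⟩ := parabolaChord_inter hz1 hz2
      (fun h => hne (Subtype.ext (show s(x, y) = s(x', y') by rw [hidx h.1, hidx h.2])))
      (hcross _ _ _ _ he hf) (hcross _ _ _ _ hf he)
    obtain ⟨t, rfl⟩ : ∃ t, i = idx t := by
      rcases hi with rfl | rfl
      · exact ⟨_, rfl⟩
      · exact ⟨_, rfl⟩
    refine ⟨t, ⟨?_, ?_⟩, rfl⟩
    · simpa [hidx.eq_iff] using hi
    · simpa [hidx.eq_iff] using hi'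

theorem not_isBounded_setOf_im_le (x y : ℝ) : ¬ IsBounded {w : ℂ | w.re = x ∧ w.im ≤ y} := by
  intro h
  obtain ⟨R, hR⟩ := h.subset_closedBall 0
  have hm : (⟨x, -(|y| + |R| + 1)⟩ : ℂ) ∈ {w : ℂ | w.re = x ∧ w.im ≤ y} :=
    ⟨rfl, by have := neg_abs_le y; have := abs_nonneg R; simp only; linarith⟩
  have h1 := hR hm
  rw [mem_closedBall, dist_zero_right] at h1
  have h2 := (Complex.abs_im_le_norm _).trans h1
  simp only [abs_neg] at h2
  have h3 := le_abs_self (|y| + |R| + 1)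
  have := le_abs_self R
  have := abs_nonneg y
  linarith

/-- A graph with an order of its vertices in which no two edges cross is outerplanar. -/
theorem isOuterplanar_of_not_cross (idx : V → ℕ) (hidx : Function.Injective idx)
    (hcross : ∀ x y z w, G.Adj x y → G.Adj z w →
      ¬ (idx x < idx z ∧ idx z < idx y ∧ idx y < idx w)) : G.IsOuterplanar := by
  let E := parabolaEmbedding idx hidx hcross
  have hE : ∀ z ∈ E.support, z.re ^ 2 ≤ z.im := by
    rintro z (⟨x, rfl⟩ | hz)
    · exact le_rfl
    · obtain ⟨e, x, y, -, hz⟩ := mem_iUnion.1 hz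
      exact sq_re_le_im_of_mem_parabolaChord hz
  -- The drawing lies on or above the parabola, so a point below it has a vertical ray downwards in
  -- the complement. Every vertex is a limit of such points.
  have hout : ∀ z : ℂ, z.im < z.re ^ 2 → z ∈ E.outerFace := by
    intro z hz
    have hzs : z ∈ E.supportᶜ := fun h => absurd (hE z h) (not_le.2 hz)
    have hray : {w : ℂ | w.re = z.re ∧ w.im ≤ z.im} ⊆ E.supportᶜ := by
      rintro w ⟨hw1, hw2⟩ hw
      have := hE w hw
      rw [hw1] at this
      linarith
    have hconv : Convex ℝ {w : ℂ | w.re = z.re ∧ w.im ≤ z.im} := by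
      rintro p ⟨hp1, hp2⟩ q ⟨hq1, hq2⟩ s t hs ht hst
      constructor
      · simp only [Complex.add_re, Complex.real_smul, Complex.mul_re, Complex.ofReal_re,
          Complex.ofReal_im, hp1, hq1]
        linear_combination z.re * hst
      · simp only [Complex.add_im, Complex.real_smul, Complex.mul_im, Complex.ofReal_re,
          Complex.ofReal_im]
        nlinarith
    refine ⟨hzs, fun hb => not_isBounded_setOf_im_le z.re z.im (hb.subset ?_)⟩
    exact hconv.isPreconnected.subset_connectedComponentIn ⟨rfl, le_rfl⟩ hray
  refine ⟨E, fun x => ⟨Metric.mem_closure_iff.2 fun ε hε => ?_, fun hx => ?_⟩⟩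
  · refine ⟨⟨idx x, (idx x : ℝ) ^ 2 - ε / 2⟩, hout _ (by simp only; linarith), ?_⟩
    have : E.pos x - ⟨idx x, (idx x : ℝ) ^ 2 - ε / 2⟩ = ((ε / 2 : ℝ) : ℂ) * Complex.I := by
      apply Complex.ext <;> simp [E, parabolaEmbedding]
    rw [dist_eq_norm, this, norm_mul, Complex.norm_real, Complex.norm_I, mul_one,
      Real.norm_of_nonneg (by linarith)]
    linarith
  · exact (interior_subset hx).1 (Or.inl ⟨x, rfl⟩)

end Parabola

end SimpleGraph

end PlaneTopology

/-! ### Counting noncrossing chords of odd span -/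

section NoncrossingChords

/-- The pair `(x, y)` is not crossed by any pair in `E`. -/
def IsUncrossed (E : Finset (ℕ × ℕ)) (x y : ℕ) : Prop :=
  ∀ p ∈ E, ¬ (p.1 < x ∧ x < p.2 ∧ p.2 < y) ∧ ¬ (x < p.1 ∧ p.1 < y ∧ y < p.2)

/-- The edge set of a bipartite polygon dissection with vertices `0, …, k - 1`: pairs `x < y` of
different parity, no two of which cross, among them all pairs of consecutive vertices. -/
structure IsDissection (E : Finset (ℕ × ℕ)) (k : ℕ) : Prop where
  lt : ∀ p ∈ E, p.1 < p.2
  odd : ∀ p ∈ E, (p.1 + p.2) % 2 = 1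
  uncrossed : ∀ p ∈ E, IsUncrossed E p.1 p.2
  succ : ∀ x, x + 1 < k → (x, x + 1) ∈ E

/-- The pairs in `E` inside the interval from `i` to `j`. -/
def pairsWithin (E : Finset (ℕ × ℕ)) (i j : ℕ) : Finset (ℕ × ℕ) :=
  E.filter fun p => i ≤ p.1 ∧ p.2 ≤ j

/-- The pairs in `E` inside the interval from `i` to `j`, other than `(i, j)`. -/
def properPairsWithin (E : Finset (ℕ × ℕ)) (i j : ℕ) : Finset (ℕ × ℕ) :=
  (pairsWithin E i j).erase (i, j)

theorem mem_pairsWithin {E : Finset (ℕ × ℕ)} {i j : ℕ} {p : ℕ × ℕ} :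
    p ∈ pairsWithin E i j ↔ p ∈ E ∧ i ≤ p.1 ∧ p.2 ≤ j := by
  simp [pairsWithin]

theorem mem_properPairsWithin {E : Finset (ℕ × ℕ)} {i j : ℕ} {p : ℕ × ℕ} :
    p ∈ properPairsWithin E i j ↔ ¬ (p.1 = i ∧ p.2 = j) ∧ p ∈ E ∧ i ≤ p.1 ∧ p.2 ≤ j := by
  simp [properPairsWithin, mem_pairsWithin, Prod.ext_iff]

theorem card_pairsWithin_of_mem {E : Finset (ℕ × ℕ)} {i j : ℕ} (h : (i, j) ∈ E) :
    (pairsWithin E i j).card = (properPairsWithin E i j).card + 1 :=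
  (Finset.card_erase_add_one (mem_pairsWithin.2 ⟨h, le_rfl, le_rfl⟩)).symm

theorem card_pairsWithin_le (E : Finset (ℕ × ℕ)) (i j : ℕ) :
    (pairsWithin E i j).card ≤ (properPairsWithin E i j).card + 1 :=
  Nat.le_add_of_sub_le Finset.pred_card_le_card_erase

/-- Let a be the farthest neighbour of i before j, and b the first neighbour of j from a on. All
pairs other than (i, j) lie within [i, a], [a, b] or [b, j]: the sides of the quadrilateral i, a, b,
j cut off the rest. Adding the three bounds, plus one for each of these sides, reproduces the bound
for [i, j]. The pair (i, j) itself is not counted because (a, b) is uncrossed but need not be in E;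
saturation puts it there, whence equality. -/
theorem IsDissection.card_properPairsWithin {E : Finset (ℕ × ℕ)} {k : ℕ} (hE : IsDissection E k)
    {i j : ℕ} (hij : i < j) (hjk : j < k) (hodd : (i + j) % 2 = 1) (hun : IsUncrossed E i j) :
    2 * (properPairsWithin E i j).card + 6 ≤ 3 * (j - i + 1) ∧
    ((∀ x y, x < y → y < k → (x + y) % 2 = 1 → IsUncrossed E x y → (x, y) ∈ E) →
      2 * (properPairsWithin E i j).card + 6 = 3 * (j - i + 1)) := by
  induction hd : j - i using Nat.strong_induction_on generalizing i j with
  | _ d ih =>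
  by_cases hj : j = i + 1
  · have : properPairsWithin E i j = ∅ := by
      refine Finset.eq_empty_of_forall_notMem fun p hp => ?_
      rw [mem_properPairsWithin] at hp
      have := hE.lt p hp.2.1
      omega
    rw [this, Finset.card_empty]
    omega
  · have hex1 : ∃ a, i < a ∧ a < j ∧ (i, a) ∈ E := ⟨i + 1, by omega, by omega, hE.succ i (by omega)⟩
    obtain ⟨a, ⟨hia, haj, haE⟩, hamax⟩ : ∃ a, (i < a ∧ a < j ∧ (i, a) ∈ E) ∧
        ∀ a', i < a' → a' < j → (i, a') ∈ E → a' ≤ a := by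
      have hb : BddAbove {a | i < a ∧ a < j ∧ (i, a) ∈ E} := ⟨j, fun a ha => ha.2.1.le⟩
      exact ⟨_, Nat.sSup_mem hex1 hb, fun a' h1 h2 h3 => le_csSup hb ⟨h1, h2, h3⟩⟩
    have hex2 : ∃ b, a ≤ b ∧ b < j ∧ (b, j) ∈ E := ⟨j - 1, by omega, by omega, by
      have := hE.succ (j - 1) (by omega)
      rwa [Nat.sub_add_cancel (by omega)] at this⟩
    obtain ⟨b, ⟨hab, hbj, hbE⟩, hbmin⟩ : ∃ b, (a ≤ b ∧ b < j ∧ (b, j) ∈ E) ∧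
        ∀ b', a ≤ b' → b' < j → (b', j) ∈ E → b ≤ b' :=
      ⟨_, Nat.sInf_mem hex2, fun b' h1 h2 h3 => Nat.sInf_le ⟨h1, h2, h3⟩⟩
    have o1 := hE.odd _ haE
    have o2 := hE.odd _ hbE
    simp only at o1 o2
    -- Equality would make i + j even.
    have hab' : a < b := by omega
    have hfacts : ∀ x y, (x, y) ∈ E → x < y ∧ (x = i → y < j → y ≤ a) ∧
        (y = j → a ≤ x → b ≤ x) ∧ ¬ (i < x ∧ x < a ∧ a < y) ∧ ¬ (x < b ∧ b < y ∧ y < j) ∧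
        ¬ (x < i ∧ i < y ∧ y < j) ∧ ¬ (i < x ∧ x < j ∧ j < y) := by
      intro x y hxy
      have hlt := hE.lt _ hxy
      refine ⟨hlt, ?_, ?_, (hE.uncrossed _ haE _ hxy).2, (hE.uncrossed _ hbE _ hxy).1,
        (hun _ hxy).1, (hun _ hxy).2⟩
      · rintro rfl hyj; exact hamax y hlt hyj hxy
      · rintro rfl hax; exact hbmin x hax hlt hxy
    have hunab : IsUncrossed E a b := by
      rintro ⟨x, y⟩ hxy
      obtain ⟨h1, h2, h3, h4, h5, h6, h7⟩ := hfacts x y hxy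
      simp only
      omega
    have hset : properPairsWithin E i j =
        pairsWithin E i a ∪ (pairsWithin E a b ∪ pairsWithin E b j) := by
      ext ⟨x, y⟩
      simp only [Finset.mem_union, mem_properPairsWithin, mem_pairsWithin]
      constructor
      · rintro ⟨h0, hE', hx, hy⟩
        obtain ⟨h1, h2, h3, h4, h5, h6, h7⟩ := hfacts x y hE'
        have : x < y ∧ y ≤ a ∨ a ≤ x ∧ y ≤ b ∨ b ≤ x ∧ y ≤ j := by omega
        rcases this with h | h | h
        · exact Or.inl ⟨hE', hx, h.2⟩
        · exact Or.inr (Or.inl ⟨hE', h⟩)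
        · exact Or.inr (Or.inr ⟨hE', h⟩)
      · rintro (⟨h, h1, h2⟩ | ⟨h, h1, h2⟩ | ⟨h, h1, h2⟩) <;> refine ⟨?_, h, ?_, ?_⟩ <;> omega
    have hcard : (properPairsWithin E i j).card = (pairsWithin E i a).card +
        ((pairsWithin E a b).card + (pairsWithin E b j).card) := by
      rw [hset, Finset.card_union_of_disjoint, Finset.card_union_of_disjoint]
      · refine Finset.disjoint_left.2 fun p hp hq => ?_
        rw [mem_pairsWithin] at hp hq
        have := hE.lt p hp.1
        omega
      · refine Finset.disjoint_left.2 fun p hp hq => ?_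
        rw [Finset.mem_union, mem_pairsWithin, mem_pairsWithin] at hq
        rw [mem_pairsWithin] at hp
        have := hE.lt p hp.1
        omega
    have c1 := card_pairsWithin_of_mem haE
    have c2 := card_pairsWithin_of_mem hbE
    have c3 := card_pairsWithin_le E a b
    obtain ⟨i1, e1⟩ := ih (a - i) (by omega) hia (by omega) o1 (hE.uncrossed _ haE) rfl
    obtain ⟨i2, e2⟩ := ih (j - b) (by omega) hbj (by omega) o2 (hE.uncrossed _ hbE) rfl
    obtain ⟨i3, e3⟩ := ih (b - a) (by omega) hab' (by omega) (by omega) hunab rfl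
    refine ⟨by omega, fun hsat => ?_⟩
    have e1 := e1 hsat
    have e2 := e2 hsat
    have e3 := e3 hsat
    have c4 := card_pairsWithin_of_mem (hsat a b hab' (by omega) (by omega) hunab)
    omega

/-- A bipartite dissection of a `k`-gon has at most `3 k / 2 - 2` edges, and exactly so many if it
cannot be refined. -/
theorem IsDissection.card {E : Finset (ℕ × ℕ)} {k : ℕ} (hE : IsDissection E k) (hk : 2 ≤ k)
    (heven : k % 2 = 0) (hlt : ∀ p ∈ E, p.2 < k) (h0 : (0, k - 1) ∈ E) :
    2 * E.card + 4 ≤ 3 * k ∧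
    ((∀ x y, x < y → y < k → (x + y) % 2 = 1 → IsUncrossed E x y → (x, y) ∈ E) →
      2 * E.card + 4 = 3 * k) := by
  have hall : pairsWithin E 0 (k - 1) = E := by
    ext p
    rw [mem_pairsWithin]
    refine ⟨fun h => h.1, fun h => ⟨h, Nat.zero_le _, ?_⟩⟩
    have := hlt p h
    omega
  have hc := card_pairsWithin_of_mem h0
  rw [hall] at hc
  obtain ⟨h1, h2⟩ := hE.card_properPairsWithin (i := 0) (j := k - 1) (by omega) (by omega)
    (by omega) (hE.uncrossed _ h0)
  refine ⟨by omega, fun hsat => ?_⟩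
  have := h2 hsat
  omega

end NoncrossingChords

/-! ### Cyclic sequences and Hamiltonian cycles -/

namespace SimpleGraph

variable {V : Type u} {G : SimpleGraph V}

/-- A cyclic sequence of `k` distinct vertices, consecutive ones being adjacent. For `k = 2` this is
an edge, traversed back and forth. -/
structure IsCyclicSeq (G : SimpleGraph V) (k : ℕ) (c : ℕ → V) : Prop where
  pos : 0 < k
  periodic : ∀ i, c (i + k) = c i
  adj : ∀ i, G.Adj (c i) (c (i + 1))
  inj : ∀ i j, i < j → j < i + k → c i ≠ c j

namespace IsCyclicSeq

variable {k : ℕ} {c : ℕ → V}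

/-- Rotating the sequence lets any vertex of the cycle be taken as `c 0`. -/
theorem shift (h : G.IsCyclicSeq k c) (s : ℕ) : G.IsCyclicSeq k (fun i => c (i + s)) where
  pos := h.pos
  periodic i := by rw [add_right_comm]; exact h.periodic _
  adj i := by rw [add_right_comm]; exact h.adj _
  inj i j hij hj := h.inj _ _ (by omega) (by omega)

theorem apply_mod (h : G.IsCyclicSeq k c) (i : ℕ) : c (i % k) = c i := by
  have key : ∀ q r, c (r + k * q) = c r := fun q => by
    induction q with
    | zero => simp
    | succ q ih => intro r; rw [Nat.mul_succ, ← add_assoc, h.periodic, ih]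
  conv_rhs => rw [← Nat.mod_add_div i k]
  rw [key]

theorem eq_iff (h : G.IsCyclicSeq k c) {i j : ℕ} (hi : i < k) (hj : j < k) : c i = c j ↔ i = j := by
  refine ⟨fun hij => ?_, fun hij => hij ▸ rfl⟩
  rcases lt_trichotomy i j with hlt | heq | hlt
  · exact absurd hij (h.inj _ _ hlt (by omega))
  · exact heq
  · exact absurd hij.symm (h.inj _ _ hlt (by omega))

theorem two_le (h : G.IsCyclicSeq k c) : 2 ≤ k := by
  have := h.pos
  by_contra hk
  have hk1 : k = 1 := by omega
  subst hk1
  exact G.ne_of_adj (h.adj 0) (h.periodic 0).symm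

theorem le_card [Finite V] (h : G.IsCyclicSeq k c) : k ≤ Nat.card V := by
  have := Nat.card_le_card_of_injective (fun i : Fin k => c i) (fun i j hij =>
    Fin.ext ((h.eq_iff i.2 j.2).1 hij))
  rwa [Nat.card_fin] at this

theorem preconnected_image_Icc (h : G.IsCyclicSeq k c) (s t : ℕ) :
    (G.induce (c '' Set.Icc s t)).Preconnected := by
  have key : ∀ n, (hn : s + n ≤ t) → (G.induce (c '' Set.Icc s t)).Reachable
      ⟨c s, ⟨s, ⟨le_rfl, by omega⟩, rfl⟩⟩ ⟨c (s + n), ⟨s + n, ⟨by omega, hn⟩, rfl⟩⟩ := by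
    intro n
    induction n with
    | zero => intro _; exact Reachable.refl _
    | succ n ih =>
      intro hn
      refine (ih (by omega)).trans (Adj.reachable ?_)
      exact h.adj (s + n)
  rintro ⟨_, i, hi, rfl⟩ ⟨_, j, hj, rfl⟩
  have h1 := key (i - s) (by have := hi.1; have := hi.2; omega)
  have h2 := key (j - s) (by have := hj.1; have := hj.2; omega)
  simp only [Nat.add_sub_cancel' hi.1] at h1
  simp only [Nat.add_sub_cancel' hj.1] at h2
  exact h1.symm.trans h2

theorem disjoint_image_Icc (h : G.IsCyclicSeq k c) {s t s' t' : ℕ} (h₁ : t < s')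
    (h₂ : t' < s + k) : Disjoint (c '' Set.Icc s t) (c '' Set.Icc s' t') := by
  rw [Set.disjoint_left]
  rintro _ ⟨i, hi, rfl⟩ ⟨j, hj, hij⟩
  obtain ⟨i1, i2⟩ := hi
  obtain ⟨j1, j2⟩ := hj
  exact h.inj i j (by omega) (by omega) hij.symm

theorem not_mem_image_Icc (h : G.IsCyclicSeq k c) {x s t : ℕ}
    (hx : x < s ∧ t < x + k ∨ t < x ∧ x < s + k) : c x ∉ c '' Set.Icc s t := by
  rintro ⟨i, ⟨i1, i2⟩, hi⟩
  rcases hx with hx | hx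
  · exact h.inj x i (by omega) (by omega) hi.symm
  · exact h.inj i x (by omega) (by omega) hi

end IsCyclicSeq

theorem ThetaFree.elim (h : G.ThetaFree) {x y : V} {S T U : Set V} (hxy : x ≠ y)
    (hST : Disjoint S T) (hSU : Disjoint S U) (hTU : Disjoint T U)
    (hS : x ∉ S ∧ y ∉ S ∧ (G.induce S).Preconnected ∧ (∃ a ∈ S, G.Adj x a) ∧ ∃ b ∈ S, G.Adj b y)
    (hT : x ∉ T ∧ y ∉ T ∧ (G.induce T).Preconnected ∧ (∃ a ∈ T, G.Adj x a) ∧ ∃ b ∈ T, G.Adj b y)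
    (hU : x ∉ U ∧ y ∉ U ∧ (G.induce U).Preconnected ∧ (∃ a ∈ U, G.Adj x a) ∧ ∃ b ∈ U, G.Adj b y) :
    False := by
  have hall : ∀ i : Fin 3, x ∉ (![S, T, U] : Fin 3 → Set V) i ∧ y ∉ (![S, T, U] : Fin 3 → Set V) i ∧
      (G.induce ((![S, T, U] : Fin 3 → Set V) i)).Preconnected ∧
      (∃ a ∈ (![S, T, U] : Fin 3 → Set V) i, G.Adj x a) ∧
      ∃ b ∈ (![S, T, U] : Fin 3 → Set V) i, G.Adj b y := by
    intro i
    fin_cases i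
    · exact hS
    · exact hT
    · exact hU
  refine h x y ![S, T, U] hxy ?_ (fun i => (hall i).1) (fun i => (hall i).2.1)
    (fun i => (hall i).2.2.1) (fun i => (hall i).2.2.2.1) (fun i => (hall i).2.2.2.2)
  intro i j hij
  fin_cases i <;> fin_cases j
  · exact absurd rfl hij
  · exact hST
  · exact hSU
  · exact hST.symm
  · exact absurd rfl hij
  · exact hTU
  · exact hSU.symm
  · exact hTU.symm
  · exact absurd rfl hij

namespace IsCyclicSeq

variable {k : ℕ} {c : ℕ → V}

/-- A connected set off the cycle has no two neighbours on the cycle that are not consecutive. -/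
theorem not_adj_of_thetaFree (h : G.IsCyclicSeq k c) (hG : G.ThetaFree) {D : Set V}
    (hD : (G.induce D).Preconnected) (hDc : ∀ i, c i ∉ D) {j : ℕ} (hj : 2 ≤ j) (hjk : j + 2 ≤ k)
    {d d' : V} (hd : d ∈ D) (hd' : d' ∈ D) (h0 : G.Adj d (c 0)) (h1 : G.Adj d' (c j)) : False := by
  have hdisj : ∀ s t, Disjoint (c '' Set.Icc s t) D := fun s t => by
    rw [Set.disjoint_left]
    rintro _ ⟨i, -, rfl⟩
    exact hDc i
  have e0 := h.periodic 0
  rw [zero_add] at e0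
  have a1 := h.adj (j - 1)
  have a2 := h.adj (k - 1)
  rw [Nat.sub_add_cancel (by omega)] at a1 a2
  rw [e0] at a2
  -- The two open segments of the cycle, nonempty by the bounds on j, and D form the theta.
  refine hG.elim (x := c 0) (y := c j) (S := c '' Set.Icc 1 (j - 1))
    (T := c '' Set.Icc (j + 1) (k - 1)) (U := D) (h.inj _ _ (by omega) (by omega))
    (h.disjoint_image_Icc (by omega) (by omega)) (hdisj _ _) (hdisj _ _)
    ⟨h.not_mem_image_Icc (by omega), h.not_mem_image_Icc (by omega), h.preconnected_image_Icc _ _,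
      ⟨c 1, ⟨1, ⟨by omega, by omega⟩, rfl⟩, h.adj 0⟩,
      ⟨c (j - 1), ⟨j - 1, ⟨by omega, by omega⟩, rfl⟩, a1⟩⟩
    ⟨h.not_mem_image_Icc (by omega), h.not_mem_image_Icc (by omega), h.preconnected_image_Icc _ _,
      ⟨c (k - 1), ⟨k - 1, ⟨by omega, by omega⟩, rfl⟩, a2.symm⟩,
      ⟨c (j + 1), ⟨j + 1, ⟨by omega, by omega⟩, rfl⟩, (h.adj j).symm⟩⟩
    ⟨hDc 0, hDc j, hD, ⟨d, hd, h0.symm⟩, ⟨d', hd', h1⟩⟩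

/-- A connected set off the cycle that has two consecutive neighbours on it gives a longer cycle. -/
theorem exists_longer (h : G.IsCyclicSeq k c) {D : Set V}
    (hD : (G.induce D).Preconnected) (hDc : ∀ i, c i ∉ D) {d d' : V} (hd : d ∈ D) (hd' : d' ∈ D)
    (h1 : G.Adj (c (k - 1)) d) (h0 : G.Adj d' (c 0)) :
    ∃ k' c', k < k' ∧ G.IsCyclicSeq k' c' := by
  obtain ⟨p, hp, hpD⟩ := hD.exists_isPath_of_induce hd hd'
  have hpos := h.pos
  set N := k + (p.length + 1) with hN
  -- The longer cycle runs once along the old one, then through D from d to d', and closes at `c 0`.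
  let e : ℕ → V := fun r => if r < k then c r else p.getVert (r - k)
  have he1 : ∀ r, r < k → e r = c r := fun r hr => if_pos hr
  have he2 : ∀ r, ¬ r < k → e r = p.getVert (r - k) := fun r hr => if_neg hr
  have hne : ∀ r s, r < N → s < N → r ≠ s → e r ≠ e s := by
    intro r s hr hs hrs
    by_cases h2 : r < k <;> by_cases h3 : s < k
    · rw [he1 r h2, he1 s h3]
      exact fun heq => hrs ((h.eq_iff h2 h3).1 heq)
    · rw [he1 r h2, he2 s h3]
      exact fun heq => hDc r (heq ▸ hpD _ (p.getVert_mem_support _))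
    · rw [he2 r h2, he1 s h3]
      exact fun heq => hDc s (heq ▸ hpD _ (p.getVert_mem_support _))
    · rw [he2 r h2, he2 s h3]
      intro heq
      have := hp.getVert_injOn (show r - k ≤ p.length by omega) (show s - k ≤ p.length by omega) heq
      omega
  refine ⟨N, fun i => e (i % N), by omega, ⟨by omega, fun i => by simp, fun i => ?_,
    fun i j hij hj => ?_⟩⟩
  · have hiN : i % N < N := Nat.mod_lt _ (by omega)
    have hsucc : (i + 1) % N = if i % N + 1 = N then 0 else i % N + 1 := by
      split_ifs with hs
      · rw [Nat.add_mod, Nat.mod_eq_of_lt (show 1 < N by omega), hs, Nat.mod_self]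
      · rw [Nat.add_mod, Nat.mod_eq_of_lt (show 1 < N by omega), Nat.mod_eq_of_lt (by omega)]
    rw [hsucc]
    generalize i % N = r at hiN
    split_ifs with hs
    · rw [he1 0 hpos, he2 r (by omega), show r - k = p.length by omega, p.getVert_length]
      exact h0
    · by_cases h2 : r + 1 < k
      · rw [he1 _ h2, he1 _ (by omega)]
        exact h.adj r
      · by_cases h3 : r < k
        · rw [he1 _ h3, he2 _ h2, show r + 1 - k = 0 by omega, p.getVert_zero,
            show r = k - 1 by omega]
          exact h1
        · rw [he2 _ h3, he2 _ h2, show r + 1 - k = r - k + 1 by omega]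
          exact p.adj_getVert_succ (by omega)
  · refine hne _ _ (Nat.mod_lt _ (by omega)) (Nat.mod_lt _ (by omega)) fun heq => ?_
    have h3 : (j - i) % N = 0 := by
      have : i ≡ j [MOD N] := heq
      exact Nat.mod_eq_zero_of_dvd ((Nat.modEq_iff_dvd' hij.le).1 this)
    rw [Nat.mod_eq_of_lt (by omega)] at h3
    omega

end IsCyclicSeq

/-- The vertices that can be reached from `w` while avoiding `S`. -/
def reachAvoiding (G : SimpleGraph V) (S : Set V) (w : V) : Set V :=
  {v | ∃ p : G.Walk w v, ∀ x ∈ p.support, x ∉ S}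

theorem preconnected_induce_reachAvoiding (S : Set V) (w : V) :
    (G.induce (G.reachAvoiding S w)).Preconnected := by
  classical
  have key : ∀ v (hv : v ∈ G.reachAvoiding S w), ∃ hw : w ∈ G.reachAvoiding S w,
      (G.induce (G.reachAvoiding S w)).Reachable ⟨w, hw⟩ ⟨v, hv⟩ := by
    rintro v ⟨p, hp⟩
    have hsub : ∀ x ∈ p.support, x ∈ G.reachAvoiding S w := fun x hx =>
      ⟨p.takeUntil x hx, fun y hy => hp y (p.support_takeUntil_subset_support hx hy)⟩
    exact ⟨hsub w p.start_mem_support, ⟨p.induce _ hsub⟩⟩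
  rintro ⟨u, hu⟩ ⟨v, hv⟩
  obtain ⟨hw, h1⟩ := key u hu
  obtain ⟨_, h2⟩ := key v hv
  exact h1.symm.trans h2

theorem mem_of_adj_reachAvoiding {S : Set V} {w u v : V} (hu : u ∈ G.reachAvoiding S w)
    (hv : v ∉ G.reachAvoiding S w) (huv : G.Adj u v) : v ∈ S := by
  by_contra hvS
  obtain ⟨p, hp⟩ := hu
  refine hv ⟨p.concat huv, fun x hx => ?_⟩
  rw [Walk.support_concat] at hx
  rcases List.mem_append.1 hx with h | h
  · exact hp x h
  · rw [List.mem_singleton.1 h]; exact hvS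

theorem IsKVertexConnected.connected_induce_compl_singleton (h : G.IsKVertexConnected 2) (s : V) :
    (G.induce {s}ᶜ).Connected := by
  have := h.2 {s} (by simp)
  rwa [Finset.coe_singleton] at this

/-- In a 2-connected graph, a vertex off a set `S` reaches two elements of `S`, each by a path that
meets `S` only there. -/
theorem IsKVertexConnected.exists_adj_of_ne (h : G.IsKVertexConnected 2) {S : Set V} {w s t : V}
    (hw : w ∉ S) (hs : s ∈ S) (ht : t ∈ S) (hst : t ≠ s) :
    ∃ u ∈ G.reachAvoiding S w, ∃ v ∈ S, v ≠ s ∧ G.Adj u v := by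
  have hws : w ≠ s := fun h => hw (h ▸ hs)
  obtain ⟨p⟩ := (h.connected_induce_compl_singleton s).preconnected ⟨w, hws⟩ ⟨t, hst⟩
  have hwD : w ∈ G.reachAvoiding S w := ⟨Walk.nil, by simpa using hw⟩
  have htD : t ∉ G.reachAvoiding S w := fun ⟨q, hq⟩ => hq t q.end_mem_support ht
  -- A walk from w to t that avoids s must leave the region reachable off S; where it does, it
  -- enters S at a vertex other than s.
  obtain ⟨d, -, hd1, hd2⟩ := p.exists_boundary_dart (Subtype.val ⁻¹' G.reachAvoiding S w) hwD htD
  exact ⟨d.fst, hd1, d.snd, mem_of_adj_reachAvoiding hd1 hd2 d.adj, d.snd.2, d.adj⟩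

theorem exists_isCyclicSeq_two {x y : V} (h : G.Adj x y) : ∃ c, G.IsCyclicSeq 2 c := by
  refine ⟨fun i => if i % 2 = 0 then x else y, by omega, fun i => by simp, fun i => ?_,
    fun i j hij hj => ?_⟩
  · rcases Nat.mod_two_eq_zero_or_one i with h2 | h2
    · simp [h2, show (i + 1) % 2 = 1 by omega, h]
    · simp [h2, show (i + 1) % 2 = 0 by omega, h.symm]
  · obtain rfl : j = i + 1 := by omega
    rcases Nat.mod_two_eq_zero_or_one i with h2 | h2
    · simp [h2, show (i + 1) % 2 = 1 by omega, G.ne_of_adj h]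
    · simp [h2, show (i + 1) % 2 = 0 by omega, (G.ne_of_adj h).symm]

theorem IsKVertexConnected.exists_adj (h : G.IsKVertexConnected 2) : ∃ x y, G.Adj x y := by
  have hc : (G.induce (((∅ : Finset V) : Set V)ᶜ)).Connected := h.2 ∅ (by simp)
  have h3 := h.1
  have : Finite V := Nat.finite_of_card_ne_zero (by omega)
  have : Nontrivial V := Finite.one_lt_card_iff_nontrivial.1 (by omega)
  obtain ⟨x, y, hxy⟩ := exists_pair_ne V
  obtain ⟨p⟩ := hc.preconnected ⟨x, by simp⟩ ⟨y, by simp⟩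
  cases p with
  | nil => exact absurd rfl hxy
  | cons h _ => exact ⟨_, _, h⟩

/-- A 2-connected theta-free graph has a Hamiltonian cycle. -/
theorem IsKVertexConnected.exists_hamiltonian (h : G.IsKVertexConnected 2) (hG : G.ThetaFree) :
    ∃ c, G.IsCyclicSeq (Nat.card V) c ∧ Function.Surjective c := by
  have h3 := h.1
  have : Finite V := Nat.finite_of_card_ne_zero (by omega)
  obtain ⟨x, y, hxy⟩ := h.exists_adj
  have hb : BddAbove {k | ∃ c, G.IsCyclicSeq k c} := ⟨Nat.card V, fun k ⟨c, hc⟩ => hc.le_card⟩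
  obtain ⟨k, ⟨c, hc⟩, hmax⟩ : ∃ k, (∃ c, G.IsCyclicSeq k c) ∧
      ∀ k' c', G.IsCyclicSeq k' c' → k' ≤ k :=
    ⟨_, Nat.sSup_mem ⟨2, exists_isCyclicSeq_two hxy⟩ hb, fun k' c' h => le_csSup hb ⟨c', h⟩⟩
  have hsurj : Function.Surjective c := by
    by_contra hns
    simp only [Function.Surjective, not_forall] at hns
    obtain ⟨w, hw⟩ := hns
    have h2 := hc.two_le
    have hDc : ∀ i, c i ∉ G.reachAvoiding (Set.range c) w := fun i ⟨q, hq⟩ =>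
      hq _ q.end_mem_support ⟨i, rfl⟩
    have hD := G.preconnected_induce_reachAvoiding (Set.range c) w
    obtain ⟨u, hu, _, ⟨i, rfl⟩, -, hui⟩ := h.exists_adj_of_ne (S := Set.range c) hw ⟨0, rfl⟩
      ⟨1, rfl⟩ (hc.inj 0 1 (by omega) (by omega)).symm
    obtain ⟨u', hu', _, ⟨j, rfl⟩, hji, huj⟩ := h.exists_adj_of_ne (S := Set.range c) hw ⟨i, rfl⟩
      ⟨i + 1, rfl⟩ (G.ne_of_adj (hc.adj i)).symm
    -- The index of the second attachment relative to the first; `i * (k - 1)` serves as -i modulo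
    -- k.
    obtain ⟨j', hj'k, hj'⟩ : ∃ j', j' < k ∧ c (j' + i) = c j := by
      refine ⟨(j + i * (k - 1)) % k, Nat.mod_lt _ hc.pos, ?_⟩
      rw [← hc.apply_mod, Nat.mod_add_mod, show j + i * (k - 1) + i = j + i * k by
        rw [add_assoc, ← Nat.mul_succ, Nat.succ_eq_add_one, Nat.sub_add_cancel hc.pos],
        Nat.add_mul_mod_self_right, hc.apply_mod]
    rw [← hj'] at huj hji
    have hj'0 : j' ≠ 0 := by rintro rfl; simp at hji
    have hs := hc.shift i
    -- Consecutive attachments on either side lengthen a longest cycle; any others give a theta. For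
    -- k = 2 the two consecutive cases coincide, so starting from a single edge does no harm.
    by_cases h1 : j' = 1
    · subst h1
      obtain ⟨k', c', hkk, hc'⟩ := (hc.shift (i + 1)).exists_longer hD (fun t => hDc _) hu hu'
        (by
          rw [show k - 1 + (i + 1) = i + k by omega, hc.periodic]
          exact hui.symm) (by simpa [add_comm] using huj)
      have := hmax k' c' hc'
      omega
    · by_cases h1 : j' = k - 1
      · subst h1
        obtain ⟨k', c', hkk, hc'⟩ := hs.exists_longer hD (fun t => hDc _) hu' hu huj.symm
          (by simpa using hui)
        have := hmax k' c' hc'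
        omega
      · exact hs.not_adj_of_thetaFree hG hD (fun t => hDc _) (j := j') (by omega) (by omega) hu hu'
          (by simpa using hui) huj
  have hk : Nat.card V = k := by
    refine le_antisymm ?_ hc.le_card
    have := Nat.card_le_card_of_surjective (fun i : Fin k => c i) fun v => by
      obtain ⟨i, rfl⟩ := hsurj v
      exact ⟨⟨i % k, Nat.mod_lt _ hc.pos⟩, hc.apply_mod i⟩
    rwa [Nat.card_fin] at this
  rw [hk]
  exact ⟨c, hc, hsurj⟩

end SimpleGraph

/-! ### Chords of a Hamiltonian cycle in a bipartite graph -/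

namespace SimpleGraph

variable {V : Type u} {G : SimpleGraph V}

namespace IsCyclicSeq

variable {k : ℕ} {c : ℕ → V}

theorem color_eq_iff (h : G.IsCyclicSeq k c) (col : G.Coloring (Fin 2)) (i : ℕ) :
    col (c i) = col (c 0) ↔ i % 2 = 0 := by
  induction i with
  | zero => simp
  | succ i ih =>
    have hne := col.valid (h.adj i)
    rw [Ne, Fin.ext_iff] at hne
    rw [Fin.ext_iff] at ih ⊢
    omega

theorem color_ne_iff (h : G.IsCyclicSeq k c) (col : G.Coloring (Fin 2)) (i j : ℕ) :
    col (c i) ≠ col (c j) ↔ (i + j) % 2 = 1 := by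
  have h1 := h.color_eq_iff col i
  have h2 := h.color_eq_iff col j
  rw [Fin.ext_iff] at h1 h2
  rw [Ne, Fin.ext_iff]
  omega

theorem even_of_isBipartite (h : G.IsCyclicSeq k c) (hG : G.IsBipartite) : k % 2 = 0 := by
  obtain ⟨col⟩ := hG
  rw [← h.color_eq_iff col]
  have := h.periodic 0
  rw [zero_add] at this
  rw [this]

theorem odd_of_adj (h : G.IsCyclicSeq k c) (hG : G.IsBipartite) {i j : ℕ}
    (hij : G.Adj (c i) (c j)) : (i + j) % 2 = 1 := by
  obtain ⟨col⟩ := hG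
  exact (h.color_ne_iff col i j).1 (col.valid hij)

/-- In a theta-free bipartite graph the chords of a cycle do not cross. -/
theorem not_cross (h : G.IsCyclicSeq k c) (hG : G.IsBipartite) (hθ : G.ThetaFree) {a p b q : ℕ}
    (hap : a < p) (hpb : p < b) (hbq : b < q) (hqa : q < a + k) (hab : G.Adj (c a) (c b))
    (hpq : G.Adj (c p) (c q)) : False := by
  have o1 := h.odd_of_adj hG hab
  have o2 := h.odd_of_adj hG hpq
  have p1 := h.adj (p - 1)
  have b1 := h.adj (b - 1)
  rw [Nat.sub_add_cancel (by omega)] at p1 b1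
  -- The theta needs two terminals with a nonempty segment between them. As a + b and p + q are odd,
  -- either a and p or p and b have equal parity, hence are at least 2 apart. Bipartiteness matters:
  -- K₄ is theta-free although two of its edges cross as chords of a 4-cycle.
  by_cases hpar : (a + p) % 2 = 0
  · have e1 := h.adj (a + k - 1)
    rw [Nat.sub_add_cancel (by omega), h.periodic] at e1
    exact hθ.elim (x := c a) (y := c p) (S := c '' Set.Icc (a + 1) (p - 1))
      (T := c '' Set.Icc (p + 1) b) (U := c '' Set.Icc q (a + k - 1))
      (h.inj _ _ (by omega) (by omega))
      (h.disjoint_image_Icc (by omega) (by omega)) (h.disjoint_image_Icc (by omega) (by omega))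
      (h.disjoint_image_Icc (by omega) (by omega))
      ⟨h.not_mem_image_Icc (by omega), h.not_mem_image_Icc (by omega),
        h.preconnected_image_Icc _ _, ⟨c (a + 1), ⟨_, ⟨by omega, by omega⟩, rfl⟩, h.adj a⟩,
        ⟨c (p - 1), ⟨_, ⟨by omega, by omega⟩, rfl⟩, p1⟩⟩
      ⟨h.not_mem_image_Icc (by omega), h.not_mem_image_Icc (by omega),
        h.preconnected_image_Icc _ _, ⟨c b, ⟨_, ⟨by omega, by omega⟩, rfl⟩, hab⟩,
        ⟨c (p + 1), ⟨_, ⟨by omega, by omega⟩, rfl⟩, (h.adj p).symm⟩⟩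
      ⟨h.not_mem_image_Icc (by omega), h.not_mem_image_Icc (by omega),
        h.preconnected_image_Icc _ _, ⟨c (a + k - 1), ⟨_, ⟨by omega, by omega⟩, rfl⟩, e1.symm⟩,
        ⟨c q, ⟨_, ⟨by omega, by omega⟩, rfl⟩, hpq.symm⟩⟩
  · exact hθ.elim (x := c p) (y := c b) (S := c '' Set.Icc (p + 1) (b - 1))
      (T := c '' Set.Icc (b + 1) q) (U := c '' Set.Icc a (p - 1))
      (h.inj _ _ (by omega) (by omega))
      (h.disjoint_image_Icc (by omega) (by omega))
      (h.disjoint_image_Icc (by omega) (by omega)).symm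
      (h.disjoint_image_Icc (by omega) (by omega)).symm
      ⟨h.not_mem_image_Icc (by omega), h.not_mem_image_Icc (by omega),
        h.preconnected_image_Icc _ _, ⟨c (p + 1), ⟨_, ⟨by omega, by omega⟩, rfl⟩, h.adj p⟩,
        ⟨c (b - 1), ⟨_, ⟨by omega, by omega⟩, rfl⟩, b1⟩⟩
      ⟨h.not_mem_image_Icc (by omega), h.not_mem_image_Icc (by omega),
        h.preconnected_image_Icc _ _, ⟨c q, ⟨_, ⟨by omega, by omega⟩, rfl⟩, hpq⟩,
        ⟨c (b + 1), ⟨_, ⟨by omega, by omega⟩, rfl⟩, (h.adj b).symm⟩⟩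
      ⟨h.not_mem_image_Icc (by omega), h.not_mem_image_Icc (by omega),
        h.preconnected_image_Icc _ _, ⟨c (p - 1), ⟨_, ⟨by omega, by omega⟩, rfl⟩, p1.symm⟩,
        ⟨c a, ⟨_, ⟨by omega, by omega⟩, rfl⟩, hab⟩⟩

end IsCyclicSeq

open Classical in
/-- The edges of `G` between the vertices `c 0, …, c (k - 1)`, as pairs of indices. -/
noncomputable def indexPairs (G : SimpleGraph V) (k : ℕ) (c : ℕ → V) : Finset (ℕ × ℕ) :=
  (Finset.range k ×ˢ Finset.range k).filter fun p => p.1 < p.2 ∧ G.Adj (c p.1) (c p.2)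

theorem mem_indexPairs {k : ℕ} {c : ℕ → V} {x y : ℕ} :
    (x, y) ∈ G.indexPairs k c ↔ x < y ∧ y < k ∧ G.Adj (c x) (c y) := by
  simp only [indexPairs, Finset.mem_filter, Finset.mem_product, Finset.mem_range]
  constructor
  · rintro ⟨⟨-, h2⟩, h3, h4⟩; exact ⟨h3, h2, h4⟩
  · rintro ⟨h1, h2, h3⟩; exact ⟨⟨h1.trans h2, h2⟩, h1, h3⟩

namespace IsCyclicSeq

variable {k : ℕ} {c : ℕ → V}

theorem isDissection_indexPairs (h : G.IsCyclicSeq k c) (hG : G.IsBipartite) (hθ : G.ThetaFree) :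
    IsDissection (G.indexPairs k c) k where
  lt := by
    rintro ⟨x, y⟩ hp
    exact (mem_indexPairs.1 hp).1
  odd := by
    rintro ⟨x, y⟩ hp
    exact h.odd_of_adj hG (mem_indexPairs.1 hp).2.2
  uncrossed := by
    rintro ⟨x, y⟩ hp ⟨z, w⟩ hq
    obtain ⟨h1, h2, h3⟩ := mem_indexPairs.1 hp
    obtain ⟨h4, h5, h6⟩ := mem_indexPairs.1 hq
    exact ⟨fun ⟨i1, i2, i3⟩ => h.not_cross hG hθ i1 i2 i3 (by simp only; omega) h6 h3,
      fun ⟨i1, i2, i3⟩ => h.not_cross hG hθ i1 i2 i3 (by simp only at i1 i2 i3 ⊢; omega) h3 h6⟩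
  succ x hx := mem_indexPairs.2 ⟨by omega, hx, h.adj x⟩

theorem exists_lt (h : G.IsCyclicSeq k c) (hs : Function.Surjective c) (v : V) :
    ∃ i < k, c i = v := by
  obtain ⟨i, rfl⟩ := hs v
  exact ⟨i % k, Nat.mod_lt _ h.pos, h.apply_mod i⟩

theorem ncard_edgeSet (h : G.IsCyclicSeq k c) (hs : Function.Surjective c) :
    G.edgeSet.ncard = (G.indexPairs k c).card := by
  have himg : G.edgeSet = (fun p : ℕ × ℕ => s(c p.1, c p.2)) '' (G.indexPairs k c : Set (ℕ × ℕ)) := by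
    ext e
    induction e using Sym2.inductionOn with
    | _ u v =>
    constructor
    · intro he
      obtain ⟨i, hi, rfl⟩ := h.exists_lt hs u
      obtain ⟨j, hj, rfl⟩ := h.exists_lt hs v
      rcases lt_trichotomy i j with hij | hij | hij
      · exact ⟨(i, j), Finset.mem_coe.2 (mem_indexPairs.2 ⟨hij, hj, he⟩), rfl⟩
      · subst hij
        exact absurd rfl (G.ne_of_adj he)
      · exact ⟨(j, i), Finset.mem_coe.2 (mem_indexPairs.2 ⟨hij, hi, G.adj_symm he⟩), Sym2.eq_swap⟩
    · rintro ⟨⟨i, j⟩, hp, hij⟩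
      rw [← hij]
      exact (mem_indexPairs.1 (Finset.mem_coe.1 hp)).2.2
  rw [himg, Set.InjOn.ncard_image, Set.ncard_coe_finset]
  rintro ⟨i, j⟩ hp ⟨i', j'⟩ hp' heq
  obtain ⟨h1, h2, -⟩ := mem_indexPairs.1 (Finset.mem_coe.1 hp)
  obtain ⟨h3, h4, -⟩ := mem_indexPairs.1 (Finset.mem_coe.1 hp')
  rcases Sym2.eq_iff.1 heq with ⟨e1, e2⟩ | ⟨e1, e2⟩
  · rw [h.eq_iff (by omega) (by omega)] at e1 e2
    simp only at e1 e2
    rw [e1, e2]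
  · rw [h.eq_iff (by simp only; omega) (by simp only; omega)] at e1 e2
    simp only at e1 e2
    omega

/-- A chord of a Hamiltonian cycle that crosses no edge and joins vertices of different colours can
be added to a bipartite graph in which no edges cross. -/
theorem isOuterplanar_sup_edge (h : G.IsCyclicSeq k c) (hs : Function.Surjective c)
    (hE : IsDissection (G.indexPairs k c) k) {x y : ℕ} (hxy : x < y) (hy : y < k)
    (hun : IsUncrossed (G.indexPairs k c) x y) :
    (G ⊔ SimpleGraph.edge (c x) (c y)).IsOuterplanar := by
  -- The position along the Hamiltonian cycle is the vertex order for the parabola drawing.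
  choose idx hidx hc using h.exists_lt hs
  have hidxc : ∀ i < k, idx (c i) = i := fun i hi => (h.eq_iff (hidx _) hi).1 (hc _)
  have hmem : ∀ u v, (G ⊔ SimpleGraph.edge (c x) (c y)).Adj u v → idx u < idx v →
      (idx u, idx v) ∈ G.indexPairs k c ∨ idx u = x ∧ idx v = y := by
    intro u v huv hlt
    rw [sup_adj, edge_adj] at huv
    rcases huv with huv | ⟨⟨rfl, rfl⟩ | ⟨rfl, rfl⟩, -⟩
    · refine Or.inl (mem_indexPairs.2 ⟨hlt, hidx v, ?_⟩)
      rwa [hc, hc]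
    · exact Or.inr ⟨hidxc x (by omega), hidxc y hy⟩
    · rw [hidxc x (by omega), hidxc y hy] at hlt
      omega
  refine isOuterplanar_of_not_cross idx (fun u v huv => by rw [← hc u, huv, hc v]) ?_
  rintro a b a' b' hab hab' ⟨h1, h2, h3⟩
  rcases hmem a b hab (by omega) with hp | ⟨rfl, rfl⟩ <;>
    rcases hmem a' b' hab' (by omega) with hq | ⟨e1, e2⟩
  · exact (hE.uncrossed _ hp _ hq).2 ⟨h1, h2, h3⟩
  · subst e1 e2
    exact (hun _ hp).1 ⟨h1, h2, h3⟩
  · exact (hun _ hq).2 ⟨h1, h2, h3⟩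
  · omega

end IsCyclicSeq

/-! ### Order and size of 2-connected bipartite outerplanar graphs -/

theorem IsKVertexConnected.even_card (h : G.IsKVertexConnected 2) (hG : G.IsBipartite)
    (hθ : G.ThetaFree) : Nat.card V % 2 = 0 := by
  obtain ⟨c, hc, -⟩ := h.exists_hamiltonian hθ
  exact hc.even_of_isBipartite hG

theorem IsCyclicSeq.zero_last_mem_indexPairs {k : ℕ} {c : ℕ → V} (h : G.IsCyclicSeq k c) :
    (0, k - 1) ∈ G.indexPairs k c := by
  have h2 := h.two_le
  refine mem_indexPairs.2 ⟨by omega, by omega, ?_⟩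
  have h1 := h.adj (k - 1)
  have h0 := h.periodic 0
  rw [Nat.sub_add_cancel (by omega)] at h1
  rw [zero_add] at h0
  rw [h0] at h1
  exact h1.symm

theorem IsKVertexConnected.two_mul_ncard_edgeSet_le (h : G.IsKVertexConnected 2)
    (hG : G.IsBipartite) (hθ : G.ThetaFree) : 2 * G.edgeSet.ncard + 4 ≤ 3 * Nat.card V := by
  obtain ⟨c, hc, hs⟩ := h.exists_hamiltonian hθ
  rw [hc.ncard_edgeSet hs]
  exact ((hc.isDissection_indexPairs hG hθ).card hc.two_le (hc.even_of_isBipartite hG)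
    (fun p hp => (mem_indexPairs.1 hp).2.1) hc.zero_last_mem_indexPairs).1

/-- Maximality saturates the dissection: a missing uncrossed pair of different parity joins vertices
of different colours, so it could be added within both classes. -/
theorem IsKVertexConnected.two_mul_ncard_edgeSet_eq [Finite V] (h : G.IsKVertexConnected 2)
    (hm : G.IsMaximalBipartiteOuterplanar) : 2 * G.edgeSet.ncard + 4 = 3 * Nat.card V := by
  obtain ⟨hG, hout, hmax⟩ := hm
  have hθ := hout.thetaFree
  obtain ⟨c, hc, hs⟩ := h.exists_hamiltonian hθ
  have hE := hc.isDissection_indexPairs hG hθ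
  rw [hc.ncard_edgeSet hs]
  refine (hE.card hc.two_le (hc.even_of_isBipartite hG)
    (fun p hp => (mem_indexPairs.1 hp).2.1) hc.zero_last_mem_indexPairs).2 ?_
  intro x y hxy hy hodd hun
  by_contra hnot
  have hnadj : ¬ G.Adj (c x) (c y) := fun hadj => hnot (mem_indexPairs.2 ⟨hxy, hy, hadj⟩)
  refine hmax _ _ (hc.inj x y hxy (by omega)) hnadj ⟨?_, hc.isOuterplanar_sup_edge hs hE hxy hy hun⟩
  obtain ⟨col⟩ := hG
  have hcol := (hc.color_ne_iff col x y).2 hodd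
  refine ⟨Coloring.mk col fun {u v} huv => ?_⟩
  rw [sup_adj, edge_adj] at huv
  rcases huv with huv | ⟨⟨rfl, rfl⟩ | ⟨rfl, rfl⟩, -⟩
  · exact col.valid huv
  · exact hcol
  · exact hcol.symm

/-! ### Separations and the general bound -/

/-- A graph on at least three vertices that is not 2-connected is the union of two proper induced
subgraphs with at most one common vertex. -/
theorem exists_separation [Finite V] (hV : 3 ≤ Nat.card V) (h : ¬ G.IsKVertexConnected 2) :
    ∃ A B : Set V, A ∪ B = Set.univ ∧ (A ∩ B).ncard ≤ 1 ∧ (A ∩ B).ncard < A.ncard ∧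
      (A ∩ B).ncard < B.ncard ∧ A.ncard + B.ncard = Nat.card V + (A ∩ B).ncard ∧
      ∀ x y, G.Adj x y → x ∈ A ∧ y ∈ A ∨ x ∈ B ∧ y ∈ B := by
  have hex : ∃ S : Finset V, S.card < 2 ∧ ¬ (G.induce ((S : Set V)ᶜ)).Connected := by
    by_contra! hall
    exact h ⟨hV, hall⟩
  obtain ⟨S, hS, hnc⟩ := hex
  have hne : Nonempty ((S : Set V)ᶜ : Set V) := by
    by_contra hemp
    rw [Set.nonempty_coe_sort, Set.not_nonempty_iff_eq_empty, Set.compl_empty_iff] at hemp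
    have := Set.ncard_univ V
    rw [← hemp, Set.ncard_coe_finset] at this
    omega
  have hnp : ¬ (G.induce ((S : Set V)ᶜ)).Preconnected := fun hp => hnc ⟨hp⟩
  simp only [Preconnected, not_forall] at hnp
  obtain ⟨⟨u, hu⟩, ⟨v, hv⟩, huv⟩ := hnp
  -- R is one component after deletion of S. Edges leave R only into S, so R ∪ S and the complement
  -- of R cover all edges and meet exactly in S.
  set R := G.reachAvoiding (S : Set V) u with hR
  have hRS : ∀ x ∈ R, x ∉ (S : Set V) := fun x ⟨p, hp⟩ => hp x p.end_mem_support
  have huR : u ∈ R := ⟨Walk.nil, by simpa using hu⟩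
  have hvR : v ∉ R := fun ⟨p, hp⟩ => huv ⟨p.induce _ hp⟩
  have hint : (R ∪ S) ∩ Rᶜ = S := by
    ext x
    constructor
    · rintro ⟨h1 | h1, h2⟩
      · exact absurd h1 h2
      · exact h1
    · exact fun hx => ⟨Or.inr hx, fun hxR => hRS x hxR hx⟩
  refine ⟨R ∪ S, Rᶜ, ?_, ?_, ?_, ?_, ?_, ?_⟩
  · ext x
    by_cases hx : x ∈ R <;> simp [hx]
  · rw [hint, Set.ncard_coe_finset]; omega
  · rw [hint]
    exact Set.ncard_lt_ncard ⟨Set.subset_union_right, fun hsub => hu (hsub (Or.inl huR))⟩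
  · rw [hint]
    exact Set.ncard_lt_ncard ⟨fun x hx hxR => hRS x hxR hx, fun hsub => hv (hsub hvR)⟩
  · rw [← Set.ncard_union_add_ncard_inter]
    congr 1
    rw [← Set.ncard_univ]
    congr 1
    ext x
    by_cases hx : x ∈ R <;> simp [hx]
  · intro x y hxy
    by_cases hx : x ∈ R
    · left
      refine ⟨Or.inl hx, ?_⟩
      by_cases hy : y ∈ R
      · exact Or.inl hy
      · exact Or.inr (mem_of_adj_reachAvoiding hx hy hxy)
    · by_cases hy : y ∈ R
      · exact Or.inl ⟨Or.inr (mem_of_adj_reachAvoiding hy hx hxy.symm), Or.inl hy⟩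
      · exact Or.inr ⟨hx, hy⟩

theorem ncard_edgeSet_le_of_cover [Finite V] {A B : Set V}
    (h : ∀ x y, G.Adj x y → x ∈ A ∧ y ∈ A ∨ x ∈ B ∧ y ∈ B) :
    G.edgeSet.ncard ≤ (G.induce A).edgeSet.ncard + (G.induce B).edgeSet.ncard := by
  have hsub : G.edgeSet ⊆ Sym2.map Subtype.val '' (G.induce A).edgeSet ∪
      Sym2.map Subtype.val '' (G.induce B).edgeSet := by
    intro e he
    induction e using Sym2.inductionOn with
    | _ x y =>
    rcases h x y he with ⟨hx, hy⟩ | ⟨hx, hy⟩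
    · exact Or.inl ⟨s(⟨x, hx⟩, ⟨y, hy⟩), he, rfl⟩
    · exact Or.inr ⟨s(⟨x, hx⟩, ⟨y, hy⟩), he, rfl⟩
  refine (Set.ncard_le_ncard hsub (Set.toFinite _)).trans ((Set.ncard_union_le _ _).trans ?_)
  exact add_le_add (Set.ncard_image_le (Set.toFinite _)) (Set.ncard_image_le (Set.toFinite _))

theorem ncard_edgeSet_le_choose_two [Finite V] : G.edgeSet.ncard ≤ (Nat.card V).choose 2 := by
  classical
  have := Fintype.ofFinite V
  rw [Nat.card_eq_fintype_card, ← coe_edgeFinset, Set.ncard_coe_finset]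
  exact card_edgeFinset_le_card_choose_two

theorem IsBipartite.induce (h : G.IsBipartite) (A : Set V) : (G.induce A).IsBipartite :=
  Colorable.of_hom (Embedding.induce A).toHom h

theorem IsOuterplanar.induce (h : G.IsOuterplanar) (A : Set V) : (G.induce A).IsOuterplanar :=
  h.of_injective_hom (Embedding.induce A).toHom Subtype.val_injective

/-- A bipartite outerplanar graph on `n` vertices has at most `⌊(3 n - 4) / 2⌋` edges. -/
theorem IsOuterplanar.ncard_edgeSet_le [Finite V] (hG : G.IsBipartite) (hout : G.IsOuterplanar) :
    G.edgeSet.ncard ≤ (3 * Nat.card V - 4) / 2 := by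
  induction hn : Nat.card V using Nat.strong_induction_on generalizing V with
  | _ n ih =>
  -- Truncated subtraction makes the bound 0 for n = 0 and n = 1; it is 1 for n = 2.
  by_cases hn3 : n < 3
  · have := G.ncard_edgeSet_le_choose_two
    rw [hn] at this
    interval_cases n <;> simp_all
  by_cases hc : G.IsKVertexConnected 2
  · have := hc.two_mul_ncard_edgeSet_le hG hout.thetaFree
    omega
  · obtain ⟨A, B, -, h1, hA, hB, hAB, hadj⟩ := exists_separation (by omega) hc
    -- With one common vertex both parts have at least two vertices and the bounds add up to at most
    -- (3n - 5)/2. Disjoint parts give at most (3n - 7)/2, even if one is a single vertex.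
    have hm := ncard_edgeSet_le_of_cover hadj
    have iA := ih A.ncard (by omega) (hG.induce A) (hout.induce A) (Nat.card_coe_set_eq A)
    have iB := ih B.ncard (by omega) (hG.induce B) (hout.induce B) (Nat.card_coe_set_eq B)
    omega

/-- Any separation lowers the attainable bound by at least one half, to (3n - 5)/2. -/
theorem IsOuterplanar.isKVertexConnected_of_eq [Finite V] (hG : G.IsBipartite)
    (hout : G.IsOuterplanar) (hV : 3 ≤ Nat.card V)
    (hm : 2 * G.edgeSet.ncard + 4 = 3 * Nat.card V) : G.IsKVertexConnected 2 := by
  by_contra hc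
  obtain ⟨A, B, -, h1, hA, hB, hAB, hadj⟩ := exists_separation hV hc
  have hm' := ncard_edgeSet_le_of_cover hadj
  have iA := (hout.induce A).ncard_edgeSet_le (hG.induce A)
  have iB := (hout.induce B).ncard_edgeSet_le (hG.induce B)
  rw [Nat.card_coe_set_eq] at iA iB
  omega

/-- One more edge would exceed the bound, which applies to the enlarged graph too. -/
theorem IsOuterplanar.isMaximal_of_eq [Finite V] (hG : G.IsBipartite) (hout : G.IsOuterplanar)
    (hm : 2 * G.edgeSet.ncard + 4 = 3 * Nat.card V) : G.IsMaximalBipartiteOuterplanar := by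
  refine ⟨hG, hout, fun x y hxy hnadj ⟨hG', hout'⟩ => ?_⟩
  have h1 := hout'.ncard_edgeSet_le hG'
  have h2 : (G ⊔ SimpleGraph.edge x y).edgeSet = insert s(x, y) G.edgeSet := by
    rw [edgeSet_sup, edgeSet_edge_of_ne hxy, Set.union_comm]; rfl
  rw [h2, Set.ncard_insert_of_notMem (by exact hnadj) (Set.toFinite _)] at h1
  omega

/-! ### Edge counts of complete graphs and 1-sums -/

theorem nonempty_iso_top_iff {n : ℕ} [Finite V] (hV : Nat.card V = n) :
    Nonempty (G ≃g (⊤ : SimpleGraph (Fin n))) ↔ G.edgeSet.ncard = n.choose 2 := by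
  classical
  have htop : ∀ {W : Type u} [Finite W], (⊤ : SimpleGraph W).edgeSet.ncard =
      (Nat.card W).choose 2 := by
    intro W _
    have := Fintype.ofFinite W
    rw [Nat.card_eq_fintype_card, ← coe_edgeFinset, Set.ncard_coe_finset]
    exact card_edgeFinset_top_eq_card_choose_two
  constructor
  · rintro ⟨e⟩
    have hGtop : G = ⊤ := by
      ext x y
      rw [top_adj, ← e.map_adj_iff, top_adj, e.injective.ne_iff]
    rw [hGtop, htop, hV]
  · intro h
    have hGtop : G = ⊤ := by
      rw [← edgeSet_inj]
      refine Set.eq_of_subset_of_ncard_le (edgeSet_mono le_top) ?_ (Set.toFinite _)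
      rw [h, htop, hV]
    rw [hGtop]
    exact ⟨Iso.completeGraph (Finite.equivFinOfCardEq hV)⟩

/-- A union of two induced subgraphs with exactly one common vertex is a 1-sum. -/
theorem isOneSum_induce {A B : Set V} {s : V} (hU : A ∪ B = Set.univ) (hs : A ∩ B = {s})
    (hadj : ∀ x y, G.Adj x y → x ∈ A ∧ y ∈ A ∨ x ∈ B ∧ y ∈ B) :
    IsOneSum (G.induce A) (G.induce B) G := by
  have hsAB : s ∈ A ∩ B := by rw [hs]; rfl
  refine ⟨Function.Embedding.subtype _, Function.Embedding.subtype _, ⟨s, hsAB.1⟩, ⟨s, hsAB.2⟩,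
    ?_, ?_, ?_⟩
  · rintro ⟨x, hx⟩ ⟨y, hy⟩
    simp only [Function.Embedding.subtype_apply, Subtype.mk.injEq]
    constructor
    · rintro rfl
      have : x ∈ A ∩ B := ⟨hx, hy⟩
      rw [hs] at this
      exact ⟨this, this⟩
    · rintro ⟨rfl, rfl⟩; rfl
  · simpa using hU
  · ext x y
    simp only [sup_adj, map_adj, comap_adj, Function.Embedding.subtype_apply]
    constructor
    · intro hxy
      rcases hadj x y hxy with ⟨hx, hy⟩ | ⟨hx, hy⟩
      · exact Or.inl ⟨⟨x, hx⟩, ⟨y, hy⟩, hxy, rfl, rfl⟩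
      · exact Or.inr ⟨⟨x, hx⟩, ⟨y, hy⟩, hxy, rfl, rfl⟩
    · rintro (⟨a, b, hab, rfl, rfl⟩ | ⟨a, b, hab, rfl, rfl⟩) <;> exact hab

theorem IsOneSum.card_add_card {V₁ : Type v} {V₂ : Type w} [Finite V] {G₁ : SimpleGraph V₁}
    {G₂ : SimpleGraph V₂} (h : IsOneSum G₁ G₂ G) : Nat.card V₁ + Nat.card V₂ = Nat.card V + 1 := by
  obtain ⟨f, g, a, b, hfg, hU, -⟩ := h
  have hint : Set.range f ∩ Set.range g = {f a} := by
    ext z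
    constructor
    · rintro ⟨⟨x, rfl⟩, ⟨y, hy⟩⟩
      rw [((hfg x y).1 hy.symm).1]; rfl
    · rintro rfl
      exact ⟨⟨a, rfl⟩, ⟨b, ((hfg a b).2 ⟨rfl, rfl⟩).symm⟩⟩
  have := Set.ncard_union_add_ncard_inter (Set.range f) (Set.range g)
  rw [hU, hint, Set.ncard_singleton, Set.ncard_univ, Set.ncard_range_of_injective f.injective,
    Set.ncard_range_of_injective g.injective] at this
  exact this.symm

theorem IsOneSum.ncard_edgeSet {V₁ : Type v} {V₂ : Type w} [Finite V] {G₁ : SimpleGraph V₁}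
    {G₂ : SimpleGraph V₂} (h : IsOneSum G₁ G₂ G) :
    G.edgeSet.ncard = G₁.edgeSet.ncard + G₂.edgeSet.ncard := by
  obtain ⟨f, g, a, b, hfg, -, rfl⟩ := h
  rw [edgeSet_sup, edgeSet_map, edgeSet_map, Set.ncard_union_eq ?_ (Set.toFinite _) (Set.toFinite _),
    Set.ncard_image_of_injective _ f.sym2Map.injective,
    Set.ncard_image_of_injective _ g.sym2Map.injective]
  rw [Set.disjoint_left]
  rintro _ ⟨e, he, rfl⟩ ⟨e', he', heq⟩
  induction e using Sym2.inductionOn with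
  | _ x y =>
  -- An edge coming from both summands would have both ends at the identified vertex.
  have key : ∀ z ∈ s(x, y), z = a := by
    intro z hz
    have h1 : f z ∈ Sym2.map f s(x, y) := Sym2.mem_map.2 ⟨z, hz, rfl⟩
    have h2 : Sym2.map g e' = Sym2.map f s(x, y) := heq
    rw [← h2] at h1
    obtain ⟨w, -, hw⟩ := Sym2.mem_map.1 h1
    exact ((hfg z w).1 hw.symm).1
  have hne : x ≠ y := G₁.ne_of_adj he
  exact hne ((key x (by simp)).trans (key y (by simp)).symm)

end SimpleGraph

/-! ### The equality cases -/

namespace SimpleGraph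

variable {V : Type u} {G : SimpleGraph V}

/-- An even bipartite outerplanar graph with the maximal number of edges is a `K₂` or 2-connected. -/
theorem IsOuterplanar.isKVertexConnected_or_iso_of_eq [Finite V] (hG : G.IsBipartite)
    (hout : G.IsOuterplanar) (hV : 2 ≤ Nat.card V)
    (hm : 2 * G.edgeSet.ncard + 4 = 3 * Nat.card V) :
    G.IsKVertexConnected 2 ∨ Nonempty (G ≃g (⊤ : SimpleGraph (Fin 2))) := by
  by_cases h2 : Nat.card V = 2
  · right
    rw [nonempty_iso_top_iff h2, Nat.choose_self]
    omega
  · exact Or.inl (hout.isKVertexConnected_of_eq hG (by omega) hm)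

theorem two_mul_ncard_edgeSet_eq_of_maximal_or_iso [Finite V]
    (hmax : G.IsMaximalBipartiteOuterplanar)
    (h : G.IsKVertexConnected 2 ∨ Nonempty (G ≃g (⊤ : SimpleGraph (Fin 2)))) :
    2 * G.edgeSet.ncard + 4 = 3 * Nat.card V := by
  rcases h with h | ⟨⟨e⟩⟩
  · exact h.two_mul_ncard_edgeSet_eq hmax
  · have hV : Nat.card V = 2 := by rw [Nat.card_congr e.toEquiv, Nat.card_fin]
    rw [(nonempty_iso_top_iff hV).1 ⟨e⟩, hV, Nat.choose_self]

/-- An odd bipartite outerplanar graph with the maximal number of edges is a union of two even ones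
with one common vertex. -/
theorem IsOuterplanar.exists_isOneSum_of_eq [Finite V] (hG : G.IsBipartite)
    (hout : G.IsOuterplanar) (hV : 3 ≤ Nat.card V) (hm : 2 * G.edgeSet.ncard + 5 = 3 * Nat.card V) :
    ∃ A B : Set V, IsOneSum (G.induce A) (G.induce B) G ∧ Even A.ncard ∧ Even B.ncard ∧
      2 ≤ A.ncard ∧ 2 ≤ B.ncard ∧ 2 * (G.induce A).edgeSet.ncard + 4 = 3 * A.ncard ∧
      2 * (G.induce B).edgeSet.ncard + 4 = 3 * B.ncard := by
  have hc : ¬ G.IsKVertexConnected 2 := fun hc => by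
    have := hc.even_card hG hout.thetaFree
    omega
  obtain ⟨A, B, hU, h1, hA, hB, hAB, hadj⟩ := exists_separation hV hc
  have hm' := ncard_edgeSet_le_of_cover hadj
  have iA := (hout.induce A).ncard_edgeSet_le (hG.induce A)
  have iB := (hout.induce B).ncard_edgeSet_le (hG.induce B)
  rw [Nat.card_coe_set_eq] at iA iB
  -- Disjoint parts allow at most (3n - 7)/2 edges, one too few.
  obtain ⟨s, hs⟩ := Set.ncard_eq_one.1 (show (A ∩ B).ncard = 1 by omega)
  refine ⟨A, B, isOneSum_induce hU hs hadj, ?_, ?_, ?_, ?_, ?_, ?_⟩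
  -- The orders sum to n + 1, which is even. If both were odd, rounding down would cost half an edge
  -- in each part; so both are even and both bounds are attained.
  · rw [Nat.even_iff]; omega
  · rw [Nat.even_iff]; omega
  all_goals omega

end SimpleGraph

theorem theorem1p3 {V : Type u} [Finite V] (G : SimpleGraph V)
    (hbip : G.IsBipartite) (hout : G.IsOuterplanar) :
    (Nat.card V = 1 →
      G.edgeSet.ncard ≤ 0 ∧ Nonempty (G ≃g (⊤ : SimpleGraph (Fin 1)))) ∧
    (Nat.card V = 2 →
      (G.edgeSet.ncard : ℚ) ≤ 3 / 2 * (Nat.card V : ℚ) - 2 ∧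
      ((G.edgeSet.ncard : ℚ) = 3 / 2 * (Nat.card V : ℚ) - 2 ↔
        Nonempty (G ≃g (⊤ : SimpleGraph (Fin 2))))) ∧
    (4 ≤ Nat.card V → Even (Nat.card V) →
      (G.edgeSet.ncard : ℚ) ≤ 3 / 2 * (Nat.card V : ℚ) - 2 ∧
      ((G.edgeSet.ncard : ℚ) = 3 / 2 * (Nat.card V : ℚ) - 2 ↔
        G.IsKVertexConnected 2 ∧ G.IsMaximalBipartiteOuterplanar)) ∧
    (3 ≤ Nat.card V → Odd (Nat.card V) →
      (G.edgeSet.ncard : ℚ) ≤ 3 / 2 * (Nat.card V : ℚ) - 5 / 2 ∧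
      ((G.edgeSet.ncard : ℚ) = 3 / 2 * (Nat.card V : ℚ) - 5 / 2 ↔
        ∃ (V₁ V₂ : Type u) (_ : Finite V₁) (_ : Finite V₂)
          (G₁ : SimpleGraph V₁) (G₂ : SimpleGraph V₂),
          Even (Nat.card V₁) ∧ Even (Nat.card V₂) ∧
          G₁.IsMaximalBipartiteOuterplanar ∧ G₂.IsMaximalBipartiteOuterplanar ∧
          (G₁.IsKVertexConnected 2 ∨ Nonempty (G₁ ≃g (⊤ : SimpleGraph (Fin 2)))) ∧
          (G₂.IsKVertexConnected 2 ∨ Nonempty (G₂ ≃g (⊤ : SimpleGraph (Fin 2)))) ∧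
          SimpleGraph.IsOneSum G₁ G₂ G)) := by
  have hle := hout.ncard_edgeSet_le hbip
  -- Clearing denominators turns the rational bounds into statements about naturals; r is 4 in the
  -- even case and 5 in the odd case.
  have hrat : ∀ r : ℕ, ((G.edgeSet.ncard : ℚ) ≤ 3 / 2 * (Nat.card V : ℚ) - r / 2 ↔
      2 * G.edgeSet.ncard + r ≤ 3 * Nat.card V) ∧
      ((G.edgeSet.ncard : ℚ) = 3 / 2 * (Nat.card V : ℚ) - r / 2 ↔
      2 * G.edgeSet.ncard + r = 3 * Nat.card V) := by
    intro r
    rw [← Nat.cast_le (α := ℚ), ← Nat.cast_inj (R := ℚ)]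
    push_cast
    constructor <;> constructor <;> intro h <;> linarith
  obtain ⟨hle4, heq4⟩ := hrat 4
  obtain ⟨hle5, heq5⟩ := hrat 5
  rw [show ((4 : ℕ) : ℚ) / 2 = 2 by norm_num] at hle4 heq4
  rw [show ((5 : ℕ) : ℚ) = 5 by norm_num] at hle5 heq5
  rw [hle4, heq4, hle5, heq5]
  refine ⟨fun hV => ?_, fun hV => ⟨by omega, ?_⟩, fun hV heven => ?_, fun hV hodd => ?_⟩
  · have h0 : G.edgeSet.ncard = 0 := by omega
    exact ⟨h0.le, (SimpleGraph.nonempty_iso_top_iff hV).2 h0⟩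
  · rw [SimpleGraph.nonempty_iso_top_iff hV, Nat.choose_self]
    omega
  · rw [Nat.even_iff] at heven
    refine ⟨by omega, fun hm => ⟨hout.isKVertexConnected_of_eq hbip (by omega) hm,
      hout.isMaximal_of_eq hbip hm⟩, fun h => h.1.two_mul_ncard_edgeSet_eq h.2⟩
  · rw [Nat.odd_iff] at hodd
    refine ⟨by omega, fun hm => ?_, ?_⟩
    · obtain ⟨A, B, hsum, eA, eB, cA, cB, mA, mB⟩ := hout.exists_isOneSum_of_eq hbip hV hm
      rw [← Nat.card_coe_set_eq] at eA eB cA cB mA mB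
      exact ⟨A, B, inferInstance, inferInstance, G.induce A, G.induce B, eA, eB,
        (hout.induce A).isMaximal_of_eq (hbip.induce A) mA,
        (hout.induce B).isMaximal_of_eq (hbip.induce B) mB,
        (hout.induce A).isKVertexConnected_or_iso_of_eq (hbip.induce A) cA mA,
        (hout.induce B).isKVertexConnected_or_iso_of_eq (hbip.induce B) cB mB, hsum⟩
    -- Adding the two equalities gives 2m + 8 = 3(n + 1), that is 2m + 5 = 3n.
    · rintro ⟨V₁, V₂, _, _, G₁, G₂, -, -, max₁, max₂, h₁, h₂, hsum⟩
      have e₁ := SimpleGraph.two_mul_ncard_edgeSet_eq_of_maximal_or_iso max₁ h₁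
      have e₂ := SimpleGraph.two_mul_ncard_edgeSet_eq_of_maximal_or_iso max₂ h₂
      have e₃ := hsum.card_add_card
      have e₄ := hsum.ncard_edgeSet
      omega
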